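/- Consider deterministic algorithms on a random access machine with logarithmic cost (each instruction is charged one plus the bit lengths of the numbers and addresses it handles; constant factors are immaterial). In the problem NFA ACCEPTANCE the input is a nondeterministic finite automaton $M$ (finite state set, one initial state, no $\epsilon$-transitions) given by the list of its transitions and the list of its final states, together with a word $x$, and the question is whether $M$ accepts $x$. For a constant $K$, call an instance $(M,x)$ with $n$ states $K$-sparse if $M$ has at most $K$ letters and at most $Kn$ transitions, and $|x|\le Kn$. Let $\varepsilon>0$. Suppose that for every $K$ there is an algorithm that decides NFA ACCEPTANCE on all $K$-sparse instances in time $O(n^{2-\varepsilon})$, where $n$ is the number of states. Then the Strong Exponential Time Hypothesis is false; that is, there is a $\delta<1$ such that for every $k$, the satisfiability of CNF formulas $\varphi$ with $n$ variables and at most $k$ literals per clause can be decided in time $O(|\varphi|^{c}\,2^{\delta n})$ for some constant $c$, where $|\varphi|$ is the length of $\varphi$ (written as a list of numbers: the number of variables, the number of clauses, and for each clause its length and its literals). -/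

import Mathlib

/-! ## Random access machines with logarithmic cost

The machine has registers `reg 0, reg 1, …` (a program names finitely many of them) and a memory
`mem` with one cell for each natural number; every register and cell holds a natural number.
Programs are built from the machine instructions by sequencing, branching and looping (structured
control flow and jumps simulate each other with a constant-factor overhead).  Executing an
instruction costs one plus the bit lengths of all the numbers it handles, including addresses. -/

namespace LogRAM

/-- The arithmetic instructions.  Subtraction is truncated at `0`, division rounds down. -/
inductive ArithOp where
  | add
  | sub
  | mul
  | div

/-- The value computed by an arithmetic instruction. -/
def ArithOp.eval : ArithOp → ℕ → ℕ → ℕ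
  | .add, x, y => x + y
  | .sub, x, y => x - y
  | .mul, x, y => x * y
  | .div, x, y => x / y

/-- Contents of the registers and of the memory. -/
structure State where
  reg : ℕ → ℕ
  mem : ℕ → ℕ

/-- Overwrite register `r` by `v`. -/
def State.setReg (s : State) (r v : ℕ) : State :=
  { s with reg := Function.update s.reg r v }

/-- Overwrite memory cell `a` by `v`. -/
def State.setMem (s : State) (a v : ℕ) : State :=
  { s with mem := Function.update s.mem a v }

/-- Programs. The arguments `r`, `a`, `b` are names of registers. -/
inductive Program where
  /-- do nothing -/
  | skip
  /-- `reg r := c` -/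
  | const (r c : ℕ)
  /-- `reg r := reg a op reg b` -/
  | arith (op : ArithOp) (r a b : ℕ)
  /-- `reg r := mem (reg a)` -/
  | load (r a : ℕ)
  /-- `mem (reg a) := reg b` -/
  | store (a b : ℕ)
  /-- first `P`, then `Q` -/
  | seq (P Q : Program)
  /-- `P` if `reg r ≠ 0`, and `Q` otherwise -/
  | ite (r : ℕ) (P Q : Program)
  /-- repeat `P` as long as `reg r ≠ 0` -/
  | loop (r : ℕ) (P : Program)

/-- `Exec P s s' t`: started in `s`, the program `P` halts in `s'`, at total cost `t`.
`Nat.size x` is the number of binary digits of `x`. -/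
inductive Exec : Program → State → State → ℕ → Prop where
  | skip (s : State) : Exec .skip s s 1
  | const (s : State) (r c : ℕ) :
      Exec (.const r c) s (s.setReg r c) (1 + Nat.size c)
  | arith (s : State) (op : ArithOp) (r a b : ℕ) :
      Exec (.arith op r a b) s (s.setReg r (op.eval (s.reg a) (s.reg b)))
        (1 + Nat.size (s.reg a) + Nat.size (s.reg b))
  | load (s : State) (r a : ℕ) :
      Exec (.load r a) s (s.setReg r (s.mem (s.reg a)))
        (1 + Nat.size (s.reg a) + Nat.size (s.mem (s.reg a)))
  | store (s : State) (a b : ℕ) :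
      Exec (.store a b) s (s.setMem (s.reg a) (s.reg b))
        (1 + Nat.size (s.reg a) + Nat.size (s.reg b))
  | seq {P Q : Program} {s s' s'' : State} {t t' : ℕ} :
      Exec P s s' t → Exec Q s' s'' t' → Exec (.seq P Q) s s'' (t + t')
  | ite_true {r : ℕ} {P Q : Program} {s s' : State} {t : ℕ} :
      s.reg r ≠ 0 → Exec P s s' t → Exec (.ite r P Q) s s' (1 + Nat.size (s.reg r) + t)
  | ite_false {r : ℕ} {P Q : Program} {s s' : State} {t : ℕ} :
      s.reg r = 0 → Exec Q s s' t → Exec (.ite r P Q) s s' (1 + t)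
  | loop_true {r : ℕ} {P : Program} {s s' s'' : State} {t t' : ℕ} :
      s.reg r ≠ 0 → Exec P s s' t → Exec (.loop r P) s' s'' t' →
        Exec (.loop r P) s s'' (1 + Nat.size (s.reg r) + t + t')
  | loop_false {r : ℕ} {P : Program} {s : State} :
      s.reg r = 0 → Exec (.loop r P) s s 1

/-- The initial state: the input is in the first memory cells; every other cell and all
registers are `0`. -/
def init (input : List ℕ) : State where
  reg := fun _ => 0
  mem := fun i => input.getD i 0

/-- On the given input, `P` halts after at most `T` steps (bit operations), and then register `0`
is nonzero if and only if the correct answer to the question is yes. -/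
def Decides (P : Program) (input : List ℕ) (answer : Prop) (T : ℝ) : Prop :=
  ∃ (s : State) (t : ℕ), Exec P (init input) s t ∧ (s.reg 0 ≠ 0 ↔ answer) ∧ (t : ℝ) ≤ T

end LogRAM

/-! ## NFA acceptance -/

/-- An instance of the acceptance problem: an NFA without `ε`-transitions, given by its number of
states (the states are `0, 1, …`, and `0` is the initial state), its number of letters, the list of
its transitions `(p, a, q)`, meaning `q ∈ δ(p, a)`, the list of its final states,
and an input word. -/
structure NFAInstance where
  numStates : ℕ
  numStates_pos : 0 < numStates
  numLetters : ℕ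
  transitions : List (Fin numStates × Fin numLetters × Fin numStates)
  transitions_nodup : transitions.Nodup
  finals : List (Fin numStates)
  finals_nodup : finals.Nodup
  word : List (Fin numLetters)

namespace NFAInstance

/-- The automaton of the instance. -/
def toNFA (I : NFAInstance) : NFA (Fin I.numLetters) (Fin I.numStates) where
  step p a := {q | (p, a, q) ∈ I.transitions}
  start := {⟨0, I.numStates_pos⟩}
  accept := {q | q ∈ I.finals}

/-- The question: is the word accepted by the automaton? -/
def Accepted (I : NFAInstance) : Prop :=
  I.word ∈ I.toNFA.accepts

/-- The instance as a list of numbers: a header with the sizes of all parts, then the transitions,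
the final states and the word. -/
def encode (I : NFAInstance) : List ℕ :=
  [I.numStates, I.numLetters, I.transitions.length, I.finals.length, I.word.length] ++
    I.transitions.flatMap (fun e => [e.1.val, e.2.1.val, e.2.2.val]) ++
    I.finals.map Fin.val ++ I.word.map Fin.val

/-- The instance is `K`-sparse: at most `K` letters, and at most `K * n` transitions and a word of
length at most `K * n`, for `n` the number of states. -/
def Sparse (K : ℕ) (I : NFAInstance) : Prop :=
  I.numLetters ≤ K ∧ I.transitions.length ≤ K * I.numStates ∧ I.word.length ≤ K * I.numStates

end NFAInstance

/-- Some algorithm solves NFA acceptance on all `K`-sparse instances in time `O(n ^ e)`, where `n` is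
the number of states. -/
def SparseNFAAcceptanceInTime (K : ℕ) (e : ℝ) : Prop :=
  ∃ (P : LogRAM.Program) (C : ℝ), ∀ I : NFAInstance, I.Sparse K →
    LogRAM.Decides P I.encode I.Accepted (C * (I.numStates : ℝ) ^ e)

/-! ## Satisfiability and the strong exponential time hypothesis -/

/-- A formula in conjunctive normal form: a list of clauses, each of them a list of literals.
The literal `(v, true)` is the variable `v`, and `(v, false)` is its negation. -/
structure CNFFormula where
  numVars : ℕ
  clauses : List (List (Fin numVars × Bool))

namespace CNFFormula

/-- Every clause has at most `k` literals. -/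
def IsKCNF (k : ℕ) (φ : CNFFormula) : Prop :=
  ∀ c ∈ φ.clauses, c.length ≤ k

/-- Some assignment makes a literal true in each clause. -/
def Satisfiable (φ : CNFFormula) : Prop :=
  ∃ α : Fin φ.numVars → Bool, ∀ c ∈ φ.clauses, ∃ l ∈ c, α l.1 = l.2

/-- The formula as a list of numbers: the number of variables, the number of clauses, and for each
clause its length followed by its literals, `2 * v + 1` for a variable and `2 * v` for a negated
one. -/
def encode (φ : CNFFormula) : List ℕ :=
  [φ.numVars, φ.clauses.length] ++
    φ.clauses.flatMap (fun c => c.length :: c.map (fun l => 2 * l.1.val + l.2.toNat))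

end CNFFormula

/-- Some algorithm solves `k`-SAT in time `2 ^ (δ * n)` up to a factor polynomial in the length of
the formula, where `n` is the number of variables. -/
def KSATInTime (k : ℕ) (δ : ℝ) : Prop :=
  ∃ (P : LogRAM.Program) (C : ℝ) (c : ℕ), ∀ φ : CNFFormula, φ.IsKCNF k →
    LogRAM.Decides P φ.encode φ.Satisfiable
      (C * (φ.encode.length : ℝ) ^ c * (2 : ℝ) ^ (δ * (φ.numVars : ℝ)))

/-- The strong exponential time hypothesis: for no `δ < 1` is it the case that `k`-SAT is solvable
in time `2 ^ (δ * n)` for every `k`. -/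
def SETH : Prop :=
  ∀ δ : ℝ, δ < 1 → ∃ k : ℕ, ¬ KSATInTime k δ

/-!
The proof is by splitting the variables of a formula into two halves. A formula with `n` variables and
`m` clauses is satisfiable if and only if, among the `A = 2 ^ ((n + 1) / 2)` assignments of the left
half and the `A` assignments of the right half, there are two which between them satisfy all the
clauses (`CNFFormula.satisfiable_iff_halfValue`).

An automaton finds such a pair (`accepted_ovInstance`). The word lists, for each left half assignment,
a separator `2` and then a letter `0` or `1` for each clause, saying whether the clause is satisfied.
The automaton guesses a block of the word, guesses a right half assignment at its separator, and
then reads the block along a path of `m + 1` states belonging to that right half assignment; the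
letter `0` is let through only where the right half assignment satisfies the clause. At the next
separator it moves to the final state. There are about `A * m` states, at most three times as many
transitions, three letters, and the word is no longer than the number of states, so that the
instance is `3`-sparse.

Hence an algorithm for sparse NFA acceptance in time `O(N ^ (2 - ε))` decides satisfiability in time
`2 ^ (n / 2 * (2 - ε))` up to polynomial factors, whatever the clause width `k`. Sparsification is
not needed, since a factor polynomial in the length of the formula is allowed.

The reduction itself is carried out by a machine program. It only ever appends to the memory: first a
table of the powers of two, then the encoding of the automaton (`writeNFA_spec`). Afterwards the
given program runs on even registers and with all its addresses shifted (`Exec.shift`), so that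
it finds the registers empty and its input at the beginning of an otherwise empty memory.
To bound the cost, numbers are bounded and instructions counted separately (`Runs`): all numbers
handled have bit length `O(n + m)`.
-/

/-! ### Running programs with bounded numbers -/

namespace LogRAM

/-- `Runs B P s s' n`: started in `s`, the program `P` halts in `s'`, at a cost of at most that of
`n` instructions which handle two numbers of the size of `B` each. -/
def Runs (B : ℕ) (P : Program) (s s' : State) (n : ℕ) : Prop :=
  ∃ t, Exec P s s' t ∧ t ≤ n * (2 * Nat.size B + 1)

namespace Runs

variable {B n n' : ℕ} {P Q : Program} {s s' s'' : State}

theorem mono (h : Runs B P s s' n) (hn : n ≤ n') : Runs B P s s' n' := by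
  obtain ⟨t, ht, hb⟩ := h
  exact ⟨t, ht, hb.trans (Nat.mul_le_mul_right _ hn)⟩

theorem skip : Runs B .skip s s 1 := ⟨_, .skip s, by omega⟩

theorem const {r c : ℕ} (hc : c ≤ B) : Runs B (.const r c) s (s.setReg r c) 1 :=
  ⟨_, .const s r c, by have := Nat.size_le_size hc; omega⟩

theorem arith {op : ArithOp} {r a b : ℕ} (ha : s.reg a ≤ B) (hb : s.reg b ≤ B) :
    Runs B (.arith op r a b) s (s.setReg r (op.eval (s.reg a) (s.reg b))) 1 :=
  ⟨_, .arith s op r a b, by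
    have := Nat.size_le_size ha; have := Nat.size_le_size hb; omega⟩

theorem load {r a : ℕ} (ha : s.reg a ≤ B) (hb : s.mem (s.reg a) ≤ B) :
    Runs B (.load r a) s (s.setReg r (s.mem (s.reg a))) 1 :=
  ⟨_, .load s r a, by have := Nat.size_le_size ha; have := Nat.size_le_size hb; omega⟩

theorem store {a b : ℕ} (ha : s.reg a ≤ B) (hb : s.reg b ≤ B) :
    Runs B (.store a b) s (s.setMem (s.reg a) (s.reg b)) 1 :=
  ⟨_, .store s a b, by have := Nat.size_le_size ha; have := Nat.size_le_size hb; omega⟩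

theorem seq (h : Runs B P s s' n) (h' : Runs B Q s' s'' n') :
    Runs B (.seq P Q) s s'' (n + n') := by
  obtain ⟨t, ht, hb⟩ := h
  obtain ⟨t', ht', hb'⟩ := h'
  exact ⟨_, .seq ht ht', by rw [Nat.add_mul]; omega⟩

theorem ite_true {r : ℕ} (hr : s.reg r ≠ 0) (hB : s.reg r ≤ B) (h : Runs B P s s' n) :
    Runs B (.ite r P Q) s s' (n + 1) := by
  obtain ⟨t, ht, hb⟩ := h
  exact ⟨_, .ite_true hr ht, by have := Nat.size_le_size hB; rw [Nat.add_mul]; omega⟩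

theorem ite_false {r : ℕ} (hr : s.reg r = 0) (h : Runs B Q s s' n) :
    Runs B (.ite r P Q) s s' (n + 1) := by
  obtain ⟨t, ht, hb⟩ := h
  exact ⟨_, .ite_false hr ht, by rw [Nat.add_mul]; omega⟩

theorem loop_true {r : ℕ} (hr : s.reg r ≠ 0) (hB : s.reg r ≤ B) (h : Runs B P s s' n)
    (h' : Runs B (.loop r P) s' s'' n') : Runs B (.loop r P) s s'' (n + n' + 1) := by
  obtain ⟨t, ht, hb⟩ := h
  obtain ⟨t', ht', hb'⟩ := h'
  exact ⟨_, .loop_true hr ht ht', by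
    have := Nat.size_le_size hB; rw [Nat.add_mul, Nat.add_mul]; omega⟩

theorem loop_false {r : ℕ} (hr : s.reg r = 0) : Runs B (.loop r P) s s 1 :=
  ⟨_, .loop_false hr, by omega⟩

end Runs

/-- The registers that a program may overwrite. -/
def Program.writes : Program → List ℕ
  | .skip => []
  | .const r _ => [r]
  | .arith _ r _ _ => [r]
  | .load r _ => [r]
  | .store _ _ => []
  | .seq P Q => P.writes ++ Q.writes
  | .ite _ P Q => P.writes ++ Q.writes
  | .loop _ P => P.writes

theorem Exec.reg_eq {P : Program} {s s' : State} {t r : ℕ} (h : Exec P s s' t)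
    (hr : r ∉ P.writes) : s'.reg r = s.reg r := by
  induction h with
  | skip | store | loop_false => rfl
  | const s r' c | arith s op r' a b | load s r' a =>
    simp only [Program.writes, List.mem_singleton] at hr
    exact Function.update_of_ne hr _ _
  | seq _ _ ih ih' =>
    simp only [Program.writes, List.mem_append, not_or] at hr
    rw [ih' hr.2, ih hr.1]
  | ite_true _ _ ih =>
    simp only [Program.writes, List.mem_append, not_or] at hr
    exact ih hr.1
  | ite_false _ _ ih =>
    simp only [Program.writes, List.mem_append, not_or] at hr
    exact ih hr.2
  | loop_true _ _ _ ih ih' => rw [ih' hr, ih hr]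

theorem Runs.reg_eq {B n r : ℕ} {P : Program} {s s' : State} (h : Runs B P s s' n)
    (hr : r ∉ P.writes) : s'.reg r = s.reg r := by
  obtain ⟨t, ht, -⟩ := h
  exact ht.reg_eq hr

/-! ### Straight-line code -/

namespace Program

/-- The program neither writes to the memory nor contains a loop. -/
def IsStraight : Program → Bool
  | .store _ _ => false
  | .loop _ _ => false
  | .seq P Q => P.IsStraight && Q.IsStraight
  | .ite _ P Q => P.IsStraight && Q.IsStraight
  | _ => true

/-- The contents of the registers after running straight-line code on registers `f`, with memory
`mem`. -/
def run (mem : ℕ → ℕ) : Program → (ℕ → ℕ) → ℕ → ℕ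
  | .const r c, f => Function.update f r c
  | .arith op r a b, f => Function.update f r (op.eval (f a) (f b))
  | .load r a, f => Function.update f r (mem (f a))
  | .seq P Q, f => Q.run mem (P.run mem f)
  | .ite r P Q, f => if f r = 0 then Q.run mem f else P.run mem f
  | _, f => f

/-- All the numbers handled when running straight-line code are at most `B`. -/
def Bounded (B : ℕ) (mem : ℕ → ℕ) : Program → (ℕ → ℕ) → Prop
  | .const _ c, _ => c ≤ B
  | .arith _ _ a b, f => f a ≤ B ∧ f b ≤ B
  | .load _ a, f => f a ≤ B ∧ mem (f a) ≤ B
  | .seq P Q, f => P.Bounded B mem f ∧ Q.Bounded B mem (P.run mem f)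
  | .ite r P Q, f => f r ≤ B ∧ if f r = 0 then Q.Bounded B mem f else P.Bounded B mem f
  | _, _ => True

/-- The largest number of instructions executed by straight-line code. -/
def length : Program → ℕ
  | .seq P Q => P.length + Q.length
  | .ite _ P Q => max P.length Q.length + 1
  | _ => 1

end Program

theorem Runs.straight {B : ℕ} {P : Program} (hP : P.IsStraight = true) (s : State)
    (hB : P.Bounded B s.mem s.reg) :
    Runs B P s ⟨P.run s.mem s.reg, s.mem⟩ P.length := by
  induction P generalizing s with
  | skip => exact Runs.skip
  | const r c => exact Runs.const hB
  | arith op r a b => exact Runs.arith hB.1 hB.2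
  | load r a => exact Runs.load hB.1 hB.2
  | store a b | loop r P => simp [Program.IsStraight] at hP
  | seq P Q ihP ihQ =>
    simp only [Program.IsStraight, Bool.and_eq_true] at hP
    exact (ihP hP.1 s hB.1).seq (ihQ hP.2 ⟨P.run s.mem s.reg, s.mem⟩ hB.2)
  | ite r P Q ihP ihQ =>
    simp only [Program.IsStraight, Bool.and_eq_true] at hP
    obtain ⟨hr, hB⟩ := hB
    simp only [Program.run, Program.length]
    split_ifs at hB ⊢ with h0
    · exact (Runs.ite_false h0 (ihQ hP.2 s hB)).mono (by omega)
    · exact (Runs.ite_true h0 hr (ihP hP.1 s hB)).mono (by omega)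

/-! ### Counted loops and appending to the memory -/

/-- The register that holds `1` throughout. -/
abbrev rOne : ℕ := 5

/-- The register that holds the address of the first memory cell not yet written to. -/
abbrev rOut : ℕ := 7

/-- Run `P` as often as register `r` says, counting `r` down to `0`. -/
def times (r : ℕ) (P : Program) : Program :=
  .loop r (.seq P (.arith .sub r r rOne))

/-- Loop rule: the invariant `I i` holds before round `i`, and each round takes at most `n` steps. -/
theorem Runs.times {B N r n : ℕ} {P : Program} (I : ℕ → State → Prop) (hN : N ≤ B) (hB : 1 ≤ B)
    (hr : rOne ≠ r)
    (step : ∀ i < N, ∀ s, I i s → s.reg r = N - i → s.reg rOne = 1 →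
      ∃ s', Runs B P s s' n ∧ s'.reg r = N - i ∧ s'.reg rOne = 1 ∧
        I (i + 1) (s'.setReg r (N - (i + 1))))
    {s : State} (hs : I 0 s) (hsr : s.reg r = N) (h1 : s.reg rOne = 1) :
    ∃ s', Runs B (times r P) s s' (N * (n + 2) + 1) ∧ I N s' := by
  suffices H : ∀ k i, i + k = N → ∀ s, I i s → s.reg r = N - i → s.reg rOne = 1 →
      ∃ s', Runs B (LogRAM.times r P) s s' (k * (n + 2) + 1) ∧ I N s' from
    H N 0 (by omega) s hs (by simpa using hsr) h1
  intro k
  induction k with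
  | zero =>
    intro i hi s hs hsr _
    obtain rfl : i = N := by omega
    exact ⟨s, (Runs.loop_false (by omega)).mono (by omega), hs⟩
  | succ k ih =>
    intro i hi s hs hsr h1
    obtain ⟨s', hrun, hr', h1', hI⟩ := step i (by omega) s hs hsr h1
    obtain ⟨s'', hrun', hI'⟩ := ih (i + 1) (by omega) _ hI (by simp [State.setReg])
      (by simp only [State.setReg, Function.update_of_ne hr]; exact h1')
    refine ⟨s'', ?_, hI'⟩
    have hdec := Runs.arith (B := B) (op := .sub) (r := r) (s := s') (a := r) (b := rOne)
      (by omega) (by omega)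
    simp only [ArithOp.eval, hr', h1', Nat.sub_sub] at hdec
    exact (Runs.loop_true (by omega) (by omega) (hrun.seq hdec) hrun').mono
      (by rw [Nat.succ_mul]; omega)

/-- The memory that holds the list `l`, followed by zeros. -/
def memOf (l : List ℕ) : ℕ → ℕ := fun i => l.getD i 0

theorem update_memOf (l : List ℕ) (v : ℕ) :
    Function.update (memOf l) l.length v = memOf (l ++ [v]) := by
  funext i
  rcases lt_trichotomy i l.length with h | rfl | h
  · rw [Function.update_of_ne h.ne]
    simp [memOf, List.getElem?_append_left h]
  · simp [memOf]
  · rw [Function.update_of_ne h.ne']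
    simp only [memOf, List.getD_eq_getElem?_getD]
    rw [List.getElem?_eq_none (by omega), List.getElem?_eq_none (by simp; omega)]

theorem memOf_append_left {l : List ℕ} (l' : List ℕ) {i : ℕ} (h : i < l.length) :
    memOf (l ++ l') i = memOf l i := by
  simp [memOf, List.getElem?_append_left h]

theorem memOf_append_right (l l' : List ℕ) (i : ℕ) : memOf (l ++ l') (l.length + i) = memOf l' i := by
  simp [memOf, List.getElem?_append_right]

theorem memOf_append_replicate (l : List ℕ) (k : ℕ) : memOf (l ++ List.replicate k 0) = memOf l := by
  funext i
  rcases lt_or_ge i l.length with h | h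
  · exact memOf_append_left _ h
  · obtain ⟨j, rfl⟩ := Nat.exists_eq_add_of_le h
    rw [memOf_append_right]
    simp only [memOf, List.getD_eq_getElem?_getD, List.getElem?_replicate]
    rw [List.getElem?_eq_none (by omega)]
    split_ifs <;> rfl

/-- Append the contents of the registers in the list to the memory. -/
def emit : List ℕ → Program
  | [] => .skip
  | r :: rs => .seq (.store rOut r) (.seq (.arith .add rOut rOut rOne) (emit rs))

theorem writes_emit (rs : List ℕ) : ∀ r ∈ (emit rs).writes, r = rOut := by
  induction rs with
  | nil => simp [emit, Program.writes]
  | cons r rs ih =>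
    simp only [emit, Program.writes, List.nil_append, List.mem_append, List.mem_singleton]
    rintro r (h | h)
    exacts [h, ih r h]

theorem Runs.emit {B : ℕ} (rs : List ℕ) (hrs : rOut ∉ rs) (l : List ℕ) (s : State)
    (hB : l.length + rs.length ≤ B) (hB1 : 1 ≤ B) (hv : ∀ r ∈ rs, s.reg r ≤ B)
    (h1 : s.reg rOne = 1) (hout : s.reg rOut = l.length) (hmem : s.mem = memOf l) :
    Runs B (emit rs) s
      ⟨Function.update s.reg rOut (l.length + rs.length), memOf (l ++ rs.map s.reg)⟩
      (2 * rs.length + 1) := by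
  induction rs generalizing l s with
  | nil =>
    have : s = ⟨Function.update s.reg rOut (l.length + 0), memOf (l ++ [])⟩ := by
      rw [Nat.add_zero, List.append_nil, ← hout, Function.update_eq_self, ← hmem]
    simp only [LogRAM.emit, List.length_nil, List.map_nil]
    rw [← this]
    exact Runs.skip
  | cons r rs ih =>
    simp only [List.mem_cons, not_or, List.length_cons] at hrs hB hv ⊢
    have e1 : Runs B (.store rOut r) s ⟨s.reg, memOf (l ++ [s.reg r])⟩ 1 := by
      have := Runs.store (B := B) (s := s) (a := rOut) (b := r) (by omega) (hv r (by simp))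
      rwa [State.setMem, hout, hmem, update_memOf] at this
    have e2 : Runs B (.arith .add rOut rOut rOne) ⟨s.reg, memOf (l ++ [s.reg r])⟩
        ⟨Function.update s.reg rOut (l.length + 1), memOf (l ++ [s.reg r])⟩ 1 := by
      have := Runs.arith (B := B) (s := ⟨s.reg, memOf (l ++ [s.reg r])⟩) (op := .add) (r := rOut)
        (a := rOut) (b := rOne) (by simp only; omega) (by simp only; omega)
      simpa only [State.setReg, ArithOp.eval, hout, h1] using this
    have hne : ∀ x ∈ rs, x ≠ rOut := fun x hx h => hrs.2 (h ▸ hx)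
    have e3 := ih hrs.2 (l ++ [s.reg r])
      ⟨Function.update s.reg rOut (l.length + 1), memOf (l ++ [s.reg r])⟩
      (by simp; omega)
      (fun x hx => by
        simp only [Function.update_of_ne (hne x hx)]; exact hv x (Or.inr hx))
      (by simpa using h1) (by simp) rfl
    have hmap : rs.map (Function.update s.reg rOut (l.length + 1)) = rs.map s.reg :=
      List.map_congr_left fun x hx => Function.update_of_ne (hne x hx) _ _
    simp only [Function.update_idem, hmap, List.append_assoc, List.length_append,
      List.length_singleton, List.singleton_append] at e3
    have e := e1.seq (e2.seq e3)
    simp only [List.map_cons, Nat.add_assoc, Nat.add_comm 1 rs.length] at e ⊢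
    exact e.mono (by omega)

/-! ### Running a program on a shifted memory -/

/-- The register that holds the address at which the simulated memory begins. -/
abbrev rBase : ℕ := 3

/-- A scratch register for address computations. -/
abbrev rAddr : ℕ := 1

/-- The program `P` acting on the even registers, and on the memory from the address in `rBase`
on. -/
def Program.shift : Program → Program
  | .skip => .skip
  | .const r c => .const (2 * r) c
  | .arith op r a b => .arith op (2 * r) (2 * a) (2 * b)
  | .load r a => .seq (.arith .add rAddr (2 * a) rBase) (.load (2 * r) rAddr)
  | .store a b => .seq (.arith .add rAddr (2 * a) rBase) (.store rAddr (2 * b))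
  | .seq P Q => .seq P.shift Q.shift
  | .ite r P Q => .ite (2 * r) P.shift Q.shift
  | .loop r P => .loop (2 * r) P.shift

/-- The state `S` represents the state `s` of the simulated machine, whose memory begins at address
`b`. -/
structure Represents (b : ℕ) (s S : State) : Prop where
  reg : ∀ r, S.reg (2 * r) = s.reg r
  base : S.reg rBase = b
  mem : ∀ i, S.mem (i + b) = s.mem i

namespace Represents

variable {b : ℕ} {s S : State}

theorem setReg (h : Represents b s S) (r v : ℕ) :
    Represents b (s.setReg r v) (S.setReg (2 * r) v) where
  reg x := by
    simp only [State.setReg, Function.update_apply, h.reg]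
    exact if_congr (by omega) rfl rfl
  base := by
    simp only [State.setReg]
    rw [Function.update_of_ne (show 3 ≠ 2 * r by omega), h.base]
  mem := h.mem

theorem setMem (h : Represents b s S) (a v : ℕ) :
    Represents b (s.setMem a v) (S.setMem (a + b) v) where
  reg := h.reg
  base := h.base
  mem i := by
    simp only [State.setMem, Function.update_apply, h.mem]
    exact if_congr (by omega) rfl rfl

theorem setAddr (h : Represents b s S) (v : ℕ) : Represents b s (S.setReg rAddr v) where
  reg x := by
    simp only [State.setReg]
    rw [Function.update_of_ne (show 2 * x ≠ 1 by omega), h.reg]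
  base := by
    simp only [State.setReg]
    rw [Function.update_of_ne (by decide), h.base]
  mem := h.mem

theorem exec_addr (h : Represents b s S) (a : ℕ) :
    Exec (.arith .add rAddr (2 * a) rBase) S (S.setReg rAddr (s.reg a + b))
      (1 + Nat.size (s.reg a) + Nat.size b) := by
  have := Exec.arith S .add rAddr (2 * a) rBase
  rwa [h.reg, h.base] at this

end Represents

theorem size_add_le (a b : ℕ) : Nat.size (a + b) ≤ Nat.size a + Nat.size b + 1 := by
  rw [Nat.size_le]
  have ha : a < 2 ^ (a.size + b.size) :=
    a.lt_size_self.trans_le (Nat.pow_le_pow_right (by omega) (by omega))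
  have hb : b < 2 ^ (a.size + b.size) :=
    b.lt_size_self.trans_le (Nat.pow_le_pow_right (by omega) (by omega))
  rw [Nat.pow_succ]
  omega

/-- The shifted program pays for the additional address computations with a factor that is linear
in the bit length of the shift. -/
theorem Exec.shift {P : Program} {s s' : State} {t : ℕ} (h : Exec P s s' t) {b : ℕ} {S : State}
    (hS : Represents b s S) :
    ∃ S' T, Represents b s' S' ∧ Exec P.shift S S' T ∧ T ≤ t * (4 + 2 * Nat.size b) := by
  have le_mul : ∀ x, x ≤ x * (4 + 2 * Nat.size b) := fun x => Nat.le_mul_of_pos_right _ (by omega)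
  induction h generalizing S with
  | skip s => exact ⟨S, _, hS, .skip S, le_mul _⟩
  | const s r c => exact ⟨_, _, hS.setReg r c, .const _ _ _, le_mul _⟩
  | arith s op r a b =>
    have := Exec.arith S op (2 * r) (2 * a) (2 * b)
    rw [hS.reg, hS.reg] at this
    exact ⟨_, _, hS.setReg _ _, this, le_mul _⟩
  | load s r a =>
    have e := Exec.load (S.setReg rAddr (s.reg a + b)) (2 * r) rAddr
    have ha : (S.setReg rAddr (s.reg a + b)).reg rAddr = s.reg a + b := by simp [State.setReg]
    have hm : (S.setReg rAddr (s.reg a + b)).mem (s.reg a + b) = s.mem (s.reg a) := hS.mem _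
    rw [ha, hm] at e
    refine ⟨_, _, (hS.setAddr _).setReg _ _, .seq (hS.exec_addr a) e, ?_⟩
    have := size_add_le (s.reg a) b
    nlinarith [Nat.zero_le (Nat.size (s.reg a) * Nat.size b),
      Nat.zero_le (Nat.size (s.mem (s.reg a)) * Nat.size b)]
  | store s a c =>
    have e := Exec.store (S.setReg rAddr (s.reg a + b)) rAddr (2 * c)
    have ha : (S.setReg rAddr (s.reg a + b)).reg rAddr = s.reg a + b := by simp [State.setReg]
    have hm : (S.setReg rAddr (s.reg a + b)).reg (2 * c) = s.reg c := (hS.setAddr _).reg c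
    rw [ha, hm] at e
    refine ⟨_, _, (hS.setAddr _).setMem _ _, .seq (hS.exec_addr a) e, ?_⟩
    have := size_add_le (s.reg a) b
    nlinarith [Nat.zero_le (Nat.size (s.reg a) * Nat.size b),
      Nat.zero_le (Nat.size (s.reg c) * Nat.size b)]
  | seq _ _ ih ih' =>
    obtain ⟨S₁, T₁, h₁, e₁, b₁⟩ := ih hS
    obtain ⟨S₂, T₂, h₂, e₂, b₂⟩ := ih' h₁
    exact ⟨S₂, _, h₂, .seq e₁ e₂, by rw [Nat.add_mul]; omega⟩
  | ite_true hr _ ih =>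
    obtain ⟨S₁, T₁, h₁, e₁, b₁⟩ := ih hS
    rw [← hS.reg] at hr
    refine ⟨S₁, _, h₁, .ite_true hr e₁, ?_⟩
    rw [hS.reg, Nat.add_mul]
    exact Nat.add_le_add (le_mul _) b₁
  | ite_false hr _ ih =>
    obtain ⟨S₁, T₁, h₁, e₁, b₁⟩ := ih hS
    rw [← hS.reg] at hr
    refine ⟨S₁, _, h₁, .ite_false hr e₁, ?_⟩
    rw [Nat.add_mul]
    exact Nat.add_le_add (le_mul _) b₁
  | loop_true hr _ _ ih ih' =>
    obtain ⟨S₁, T₁, h₁, e₁, b₁⟩ := ih hS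
    obtain ⟨S₂, T₂, h₂, e₂, b₂⟩ := ih' h₁
    rw [← hS.reg] at hr
    refine ⟨S₂, _, h₂, .loop_true hr e₁ e₂, ?_⟩
    rw [hS.reg, Nat.add_mul, Nat.add_mul]
    exact Nat.add_le_add (Nat.add_le_add (le_mul _) b₁) b₂
  | loop_false hr =>
    rw [← hS.reg] at hr
    exact ⟨S, _, hS, .loop_false hr, le_mul _⟩

/-! ### Evaluating clauses

All registers used are odd, since the even ones belong to the simulated program. -/

/-- The register that holds `2` throughout. -/
abbrev rTwo : ℕ := 9

/-- The register that holds the number of clauses. -/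
abbrev rM : ℕ := 11

/-- The register that holds the number of half assignments. -/
abbrev rA : ℕ := 13

/-- The register that holds the address of the table of the powers of two. -/
abbrev rTab : ℕ := 15

/-- The register that holds `0` throughout. It is never written to. -/
abbrev rZero : ℕ := 17

/-- The register that holds the position in the formula. -/
abbrev rPos : ℕ := 19

/-- The register that holds the bit set of the true variables of a half assignment. -/
abbrev rTrue : ℕ := 21

/-- The register that holds the bit set of the false variables of a half assignment. -/
abbrev rFalse : ℕ := 23

/-- The register for the truth value of a clause. -/
abbrev rVal : ℕ := 25

/-- The counter of the literals of a clause. -/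
abbrev rLits : ℕ := 27

/-- The counter of the clauses. -/
abbrev rClauses : ℕ := 29

/-- The counter of the half assignments. -/
abbrev rHalves : ℕ := 31

/-- The register that holds the state from which the next transition starts. -/
abbrev rState : ℕ := 33

/-- The register that holds the state after `rState`. -/
abbrev rNext : ℕ := 35

/-- The register that holds the state after `rState` if `rVal` is `1`, and `0` otherwise. -/
abbrev rTarget : ℕ := 37

/-- A scratch register. -/
abbrev rX : ℕ := 39

/-- A scratch register. -/
abbrev rY : ℕ := 41

/-- A scratch register. -/
abbrev rS : ℕ := 43

/-- Add to `rVal` the truth value of the literal after position `rPos`, and advance. The literal `l`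
concerns the variable `l / 2`; the power of two that selects its bit comes from the table. -/
def literalStep : Program :=
  .seq (.arith .add rPos rPos rOne) <| .seq (.load rX rPos) <| .seq (.arith .div rY rX rTwo) <|
  .seq (.arith .mul rS rY rTwo) <| .seq (.arith .sub rS rX rS) <|
  .seq (.arith .add rY rTab rY) <| .seq (.load rY rY) <|
  .seq (.ite rS (.arith .div rY rTrue rY) (.arith .div rY rFalse rY)) <|
  .seq (.arith .div rX rY rTwo) <| .seq (.arith .mul rX rX rTwo) <|
  .seq (.arith .sub rY rY rX) (.arith .add rVal rVal rY)

/-- The truth value, `0` or `1`, of the literal `l` (encoded as a number) under the partial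
assignment that makes the variables in the bit set `pos` true and those in the bit set `neg`
false. -/
def litBit (pos neg l : ℕ) : ℕ :=
  (if l % 2 = 0 then neg else pos) / 2 ^ (l / 2) % 2

theorem literalStep_spec {B p l : ℕ} {s : State} (hone : s.reg rOne = 1) (htwo : s.reg rTwo = 2)
    (hp : s.reg rPos = p) (hl : s.mem (p + 1) = l)
    (htab : s.mem (s.reg rTab + l / 2) = 2 ^ (l / 2)) (hB2 : 2 ≤ B) (hpB : p + 1 ≤ B)
    (hlB : l ≤ B) (htB : s.reg rTab + l / 2 ≤ B) (hpow : 2 ^ (l / 2) ≤ B)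
    (htrue : s.reg rTrue ≤ B) (hfalse : s.reg rFalse ≤ B) (hval : s.reg rVal ≤ B) :
    ∃ s', Runs B literalStep s s' 13 ∧ s'.mem = s.mem ∧ s'.reg rPos = p + 1 ∧
      s'.reg rVal = s.reg rVal + litBit (s.reg rTrue) (s.reg rFalse) l := by
  have hsub : ∀ x, x - x / 2 * 2 = x % 2 := fun x => by omega
  have hdiv : ∀ x y, x ≤ B → x / y ≤ B := fun x y h => (Nat.div_le_self x y).trans h
  have hdiv' : ∀ x y z, x ≤ B → x / y / z * z ≤ B := fun x y z h =>
    (Nat.div_mul_le_self _ z).trans (hdiv x y h)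
  have hmod : ∀ x, x % 2 ≤ B := fun x => by omega
  refine ⟨_, Runs.straight (by decide) s ?_, rfl, ?_, ?_⟩ <;>
    by_cases h0 : l % 2 = 0 <;>
    simp [literalStep, Program.Bounded, Program.run, ArithOp.eval, litBit, *] <;>
    omega

theorem litBit_le_one (pos neg l : ℕ) : litBit pos neg l ≤ 1 := by
  have := Nat.mod_lt ((if l % 2 = 0 then neg else pos) / 2 ^ (l / 2)) (show 0 < 2 by omega)
  unfold litBit
  omega

/-- The registers and the memory are set up for writing down the automaton: the memory holds `l`,
there are `m` clauses, `A` half assignments, a table of powers of two at address `tab`, and the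
input of the simulated machine begins at address `b`. -/
structure Ready (m A tab b : ℕ) (l : List ℕ) (s : State) : Prop where
  even : ∀ r, s.reg (2 * r) = 0
  base : s.reg rBase = b
  one : s.reg rOne = 1
  two : s.reg rTwo = 2
  zero : s.reg rZero = 0
  m : s.reg rM = m
  A : s.reg rA = A
  tab : s.reg rTab = tab
  out : s.reg rOut = l.length
  mem : s.mem = memOf l

section

variable {m A tab b B n : ℕ} {l l' : List ℕ} {s s' : State} {P : Program}

theorem Ready.of_runs (h : Ready m A tab b l s) (hP : Runs B P s s' n)
    (hw : ∀ r ∈ P.writes, 19 ≤ r ∧ r % 2 = 1 ∨ r = rOut) (hout : s'.reg rOut = l'.length)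
    (hmem : s'.mem = memOf l') : Ready m A tab b l' s' where
  even r := by
    rw [hP.reg_eq fun hr => by rcases hw _ hr with h | (h : 2 * r = 7) <;> omega, h.even]
  base := by rw [hP.reg_eq fun hr => absurd (hw _ hr) (by decide), h.base]
  one := by rw [hP.reg_eq fun hr => absurd (hw _ hr) (by decide), h.one]
  two := by rw [hP.reg_eq fun hr => absurd (hw _ hr) (by decide), h.two]
  zero := by rw [hP.reg_eq fun hr => absurd (hw _ hr) (by decide), h.zero]
  m := by rw [hP.reg_eq fun hr => absurd (hw _ hr) (by decide), h.m]
  A := by rw [hP.reg_eq fun hr => absurd (hw _ hr) (by decide), h.A]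
  tab := by rw [hP.reg_eq fun hr => absurd (hw _ hr) (by decide), h.tab]
  out := hout
  mem := hmem

theorem Ready.of_runs_of_mem_eq (h : Ready m A tab b l s) (hP : Runs B P s s' n)
    (hw : ∀ r ∈ P.writes, 19 ≤ r ∧ r % 2 = 1) (hmem : s'.mem = s.mem) : Ready m A tab b l s' :=
  h.of_runs hP (fun r hr => Or.inl (hw r hr))
    ((hP.reg_eq fun hr => absurd (hw _ hr) (by decide)).trans h.out) (hmem.trans h.mem)

theorem Ready.setReg (h : Ready m A tab b l s) {r v : ℕ} (hr : 19 ≤ r ∧ r % 2 = 1) :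
    Ready m A tab b l (s.setReg r v) :=
  h.of_runs_of_mem_eq (P := .const r v) (Runs.const le_rfl)
    (fun x hx => by rw [Program.writes, List.mem_singleton] at hx; exact hx ▸ hr) rfl

theorem Ready.emit (h : Ready m A tab b l s) (rs : List ℕ) (hrs : rOut ∉ rs)
    (hB : l.length + rs.length ≤ B) (hB1 : 1 ≤ B) (hv : ∀ r ∈ rs, s.reg r ≤ B) :
    ∃ s', Runs B (emit rs) s s' (2 * rs.length + 1) ∧ Ready m A tab b (l ++ rs.map s.reg) s' ∧
      ∀ r ≠ rOut, s'.reg r = s.reg r := by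
  have hrun := Runs.emit rs hrs l s hB hB1 hv h.one h.out h.mem
  exact ⟨_, hrun, h.of_runs hrun (fun r hr => Or.inr (writes_emit _ r hr)) (by simp) rfl,
    fun r hr => Function.update_of_ne hr _ _⟩

/-- The table of powers of two, at address `tab` of the memory `l`, covers the literal `x`. -/
def Covers (B tab : ℕ) (l : List ℕ) (x : ℕ) : Prop :=
  x ≤ B ∧ 2 ^ (x / 2) ≤ B ∧ tab + x / 2 < l.length ∧ memOf l (tab + x / 2) = 2 ^ (x / 2)

theorem Covers.append {x : ℕ} (h : Covers B tab l x) (l' : List ℕ) : Covers B tab (l ++ l') x := by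
  obtain ⟨h1, h2, h3, h4⟩ := h
  refine ⟨h1, h2, ?_, ?_⟩
  · rw [List.length_append]
    omega
  · rw [memOf_append_left l' h3, h4]

/-- Compute the truth value of the clause at position `rPos`, and advance to the next one. -/
def clauseEval : Program :=
  .seq (.load rLits rPos) <| .seq (.const rVal 0) <| .seq (times rLits literalStep) <|
  .seq (.arith .add rPos rPos rOne) (.ite rVal (.const rVal 1) .skip)

/-- The truth value of a clause under a partial assignment. -/
def clauseBit (pos neg : ℕ) (cs : List ℕ) : ℕ :=
  if (cs.map (litBit pos neg)).sum = 0 then 0 else 1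

theorem sum_litBit_le (pos neg : ℕ) (cs : List ℕ) : (cs.map (litBit pos neg)).sum ≤ cs.length := by
  simpa using List.sum_le_card_nsmul (cs.map (litBit pos neg)) 1
    (by simpa using fun a _ => litBit_le_one pos neg a)

theorem clauseEval_spec {u cs v : List ℕ} (h : Ready m A tab b l s)
    (hl : l = u ++ (cs.length :: cs) ++ v) (hlB : l.length ≤ B) (hB : 2 ≤ B)
    (hpos : s.reg rPos = u.length) (hcs : ∀ x ∈ cs, Covers B tab l x)
    (htrue : s.reg rTrue ≤ B) (hfalse : s.reg rFalse ≤ B) :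
    ∃ s', Runs B clauseEval s s' (cs.length * 15 + 6) ∧ Ready m A tab b l s' ∧
      s'.reg rPos = u.length + (cs.length + 1) ∧
      s'.reg rVal = clauseBit (s.reg rTrue) (s.reg rFalse) cs := by
  have hlen : u.length + cs.length + 1 ≤ l.length := by
    rw [hl]; simp only [List.length_append, List.length_cons]; omega
  have hhead : s.mem (s.reg rPos) = cs.length := by
    rw [h.mem, hpos, hl]
    simp [memOf]
  have hlit : ∀ i (hi : i < cs.length), memOf l (u.length + i + 1) = cs[i] := fun i hi => by
    rw [hl]
    simp [memOf, List.getElem?_append, hi, Nat.add_assoc]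
  have e1 : Runs B (.load rLits rPos) s (s.setReg rLits cs.length) 1 := by
    have := Runs.load (B := B) (r := rLits) (s := s) (a := rPos) (by omega) (by omega)
    rwa [hhead] at this
  have e2 : Runs B (.const rVal 0) (s.setReg rLits cs.length)
      ((s.setReg rLits cs.length).setReg rVal 0) 1 := Runs.const (Nat.zero_le _)
  have h2 : Ready m A tab b l ((s.setReg rLits cs.length).setReg rVal 0) :=
    (h.setReg (by decide)).setReg (by decide)
  obtain ⟨s₃, e3, h3, hpos3, hval3, htrue3, hfalse3⟩ := Runs.times (B := B) (r := rLits)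
    (N := cs.length) (n := 13) (P := literalStep)
    (fun i s' => Ready m A tab b l s' ∧ s'.reg rPos = u.length + i ∧
      s'.reg rVal = ((cs.take i).map (litBit (s.reg rTrue) (s.reg rFalse))).sum ∧
      s'.reg rTrue = s.reg rTrue ∧ s'.reg rFalse = s.reg rFalse)
    (by omega) (by omega) (by decide)
    (by
      rintro i hi s' ⟨h', hpos', hval', htrue', hfalse'⟩ hr h1
      obtain ⟨c1, c2, c3, c4⟩ := hcs cs[i] (List.getElem_mem hi)
      have hle : s'.reg rVal ≤ B := by
        have := sum_litBit_le (s.reg rTrue) (s.reg rFalse) (cs.take i)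
        rw [List.length_take] at this
        omega
      obtain ⟨s'', e, hm, hp, hv⟩ := literalStep_spec (B := B) h1 h'.two hpos'
        (by rw [h'.mem, hlit i hi]) (by rw [h'.mem, h'.tab, c4]) hB (by omega) c1
        (by rw [h'.tab]; omega) c2 (by omega) (by omega) hle
      have h'' := h'.of_runs_of_mem_eq e (by decide) hm
      refine ⟨s'', e, ?_, h''.one, h''.setReg (by decide), ?_, ?_, ?_, ?_⟩
      · rw [e.reg_eq (by decide), hr]
      · simpa [State.setReg, Nat.add_assoc] using hp
      · rw [List.take_succ_eq_append_getElem hi, List.map_append, List.sum_append, ← hval',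
          ← htrue', ← hfalse']
        simpa [State.setReg] using hv
      · simpa [State.setReg, htrue'] using e.reg_eq (r := rTrue) (by decide)
      · simpa [State.setReg, hfalse'] using e.reg_eq (r := rFalse) (by decide))
    (s := (s.setReg rLits cs.length).setReg rVal 0)
    ⟨h2, by simp [State.setReg, hpos], by simp [State.setReg], by simp [State.setReg],
      by simp [State.setReg]⟩ (by simp [State.setReg]) h2.one
  rw [List.take_length] at hval3
  have e4 : Runs B (.arith .add rPos rPos rOne) s₃ (s₃.setReg rPos (u.length + cs.length + 1)) 1 := by
    have := Runs.arith (B := B) (op := .add) (r := rPos) (s := s₃) (a := rPos) (b := rOne) (by omega)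
      (by rw [h3.one]; omega)
    rwa [ArithOp.eval, h3.one, hpos3] at this
  have hval4 : (s₃.setReg rPos (u.length + cs.length + 1)).reg rVal = s₃.reg rVal := by
    simp [State.setReg]
  have h4 : Ready m A tab b l (s₃.setReg rPos (u.length + cs.length + 1)) := h3.setReg (by decide)
  by_cases h0 : s₃.reg rVal = 0
  · refine ⟨_, (e1.seq (e2.seq (e3.seq (e4.seq (Runs.ite_false (hval4.trans h0) .skip))))).mono
      (by omega), h4, by simp [State.setReg, Nat.add_assoc], ?_⟩
    rw [hval4, h0, clauseBit, if_pos (by omega)]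
  · have hle := sum_litBit_le (s.reg rTrue) (s.reg rFalse) cs
    refine ⟨_, (e1.seq (e2.seq (e3.seq (e4.seq (Runs.ite_true (by rwa [hval4]) (by omega)
      (.const (by omega))))))).mono (by omega), h4.setReg (by decide),
      by simp [State.setReg, Nat.add_assoc], ?_⟩
    rw [clauseBit, if_neg (by omega)]
    simp [State.setReg]

end

/-! ### Going through all half assignments and all clauses -/

/-- The contents of the registers that may be written down, when `rState` holds `q` and `rVal` holds
`val`. -/
def env (q val r : ℕ) : ℕ :=
  if r = rZero then 0 else if r = rOne then 1 else if r = rTwo then 2 else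
  if r = rState then q else if r = rNext then q + 1 else if r = rVal then val else (q + 1) * val

/-- Evaluate a clause, write down the registers in the list `mid`, and go on to the next state. -/
def clauseStep (mid : List ℕ) : Program :=
  .seq clauseEval <| .seq (.arith .add rNext rState rOne) <| .seq (.arith .mul rTarget rNext rVal) <|
  .seq (emit mid) (.arith .add rState rNext rZero)

theorem mem_writes_clauseStep {mid : List ℕ} {r : ℕ} (h : r ∈ (clauseStep mid).writes) :
    r ∈ clauseEval.writes ++ [rNext, rTarget, rOut, rState] := by
  simp only [clauseStep, Program.writes, List.mem_append, List.mem_cons, List.not_mem_nil,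
    or_false] at h ⊢
  rcases h with h | h | h | h | h
  · exact Or.inl h
  · simp [h]
  · simp [h]
  · simp [writes_emit _ _ h]
  · simp [h]

section

variable {m A tab b B n k q pos neg : ℕ} {l l' : List ℕ} {s s' : State} {P : Program}

theorem clauseBit_le_one (cs : List ℕ) : clauseBit pos neg cs ≤ 1 := by
  unfold clauseBit
  split_ifs <;> omega

theorem clauseStep_spec {u cs v mid : List ℕ} (h : Ready m A tab b l s)
    (hl : l = u ++ (cs.length :: cs) ++ v) (hB : 2 ≤ B) (hlB : l.length + mid.length ≤ B)
    (hpos : s.reg rPos = u.length) (hcs : ∀ x ∈ cs, Covers B tab l x) (hk : cs.length ≤ k)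
    (hmid : ∀ r ∈ mid, r ∈ [rZero, rOne, rTwo, rState, rNext, rVal, rTarget])
    (htrue : s.reg rTrue = pos) (hfalse : s.reg rFalse = neg) (hposB : pos ≤ B) (hnegB : neg ≤ B)
    (hq : s.reg rState = q) (hqB : q + 1 ≤ B) :
    ∃ s', Runs B (clauseStep mid) s s' (k * 15 + 2 * mid.length + 10) ∧
      Ready m A tab b (l ++ mid.map (env q (clauseBit pos neg cs))) s' ∧
      s'.reg rPos = u.length + (cs.length + 1) ∧ s'.reg rState = q + 1 := by
  obtain ⟨s₁, e₁, h₁, hp₁, hv₁⟩ := clauseEval_spec h hl (by omega) hB hpos hcs (by omega) (by omega)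
  rw [htrue, hfalse] at hv₁
  set c := clauseBit pos neg cs with hc
  have hc1 : c ≤ 1 := clauseBit_le_one cs
  have hcB : (q + 1) * c ≤ q + 1 := by nlinarith
  have hq₁ : s₁.reg rState = q := by rw [e₁.reg_eq (by decide), hq]
  have e₂ := Runs.arith (B := B) (op := .add) (r := rNext) (s := s₁) (a := rState) (b := rOne)
    (by omega) (by rw [h₁.one]; omega)
  rw [ArithOp.eval, hq₁, h₁.one] at e₂
  have e₃ := Runs.arith (B := B) (op := .mul) (r := rTarget) (s := s₁.setReg rNext (q + 1))
    (a := rNext) (b := rVal) (by simpa [State.setReg]) (by simp [State.setReg, hv₁]; omega)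
  have h₃ : Ready m A tab b l ((s₁.setReg rNext (q + 1)).setReg rTarget ((q + 1) * c)) :=
    (h₁.setReg (by decide)).setReg (by decide)
  have henv : ∀ r ∈ mid, ((s₁.setReg rNext (q + 1)).setReg rTarget ((q + 1) * c)).reg r = env q c r := by
    intro r hr
    have := hmid r hr
    simp only [List.mem_cons, List.not_mem_nil, or_false] at this
    rcases this with rfl | rfl | rfl | rfl | rfl | rfl | rfl <;>
      simp [State.setReg, env, h₁.zero, h₁.one, h₁.two, hq₁, hv₁]
  have henvB : ∀ r ∈ mid, env q c r ≤ B := by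
    intro r _
    unfold env
    split_ifs <;> omega
  obtain ⟨s₄, e₄, h₄, hf₄⟩ := h₃.emit (B := B) mid (fun hr => absurd (hmid _ hr) (by decide)) hlB
    (by omega) (fun r hr => by rw [henv r hr]; exact henvB r hr)
  rw [List.map_congr_left henv] at h₄
  have hn₄ : s₄.reg rNext = q + 1 := by
    rw [hf₄ _ (by decide)]
    simp [State.setReg]
  have e₅ := Runs.arith (B := B) (op := .add) (r := rState) (s := s₄) (a := rNext) (b := rZero)
    (by omega) (by rw [h₄.zero]; omega)
  have e₃' : Runs B (.arith .mul rTarget rNext rVal) (s₁.setReg rNext (q + 1))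
      ((s₁.setReg rNext (q + 1)).setReg rTarget ((q + 1) * c)) 1 := by
    simpa [State.setReg, ArithOp.eval, hv₁] using e₃
  have e := e₁.seq (e₂.seq (e₃'.seq (e₄.seq e₅)))
  refine ⟨_, e.mono ?_, h₄.setReg (by decide), ?_, ?_⟩
  · have := Nat.mul_le_mul_right 15 hk
    omega
  · simp only [State.setReg]
    rw [Function.update_of_ne (by decide), hf₄ _ (by decide)]
    simpa [State.setReg] using hp₁
  · simp [State.setReg, ArithOp.eval, hn₄, h₄.zero]

/-- The formula part of the input: each clause is preceded by its length. -/
def clausesCode (css : List (List ℕ)) : List ℕ :=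
  css.flatMap fun cs => cs.length :: cs

theorem clausesCode_append (css css' : List (List ℕ)) :
    clausesCode (css ++ css') = clausesCode css ++ clausesCode css' :=
  List.flatMap_append

theorem clausesCode_cons (cs : List ℕ) (css : List (List ℕ)) :
    clausesCode (cs :: css) = cs.length :: cs ++ clausesCode css := rfl

theorem clausesCode_split (css : List (List ℕ)) {c : ℕ} (hc : c < css.length) :
    clausesCode css = clausesCode (css.take c) ++ (css[c].length :: css[c]) ++
      clausesCode (css.drop (c + 1)) := by
  conv_lhs => rw [← List.take_append_drop c css, List.drop_eq_getElem_cons hc]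
  rw [clausesCode_append, clausesCode_cons, List.append_assoc]

theorem length_flatMap_range {α : Type*} {f : ℕ → List α} {a : ℕ} (hf : ∀ i, (f i).length = a) (n : ℕ) :
    ((List.range n).flatMap f).length = n * a := by
  simp [List.length_flatMap, hf]

/-- What is written down for all the clauses by `clauseStep mid`, if `rState` holds `q` at first. -/
def clausesOut (mid : List ℕ) (pos neg q : ℕ) (css : List (List ℕ)) (c : ℕ) : List ℕ :=
  (List.range c).flatMap fun j => mid.map (env (q + j) (clauseBit pos neg (css.getD j [])))

theorem length_clausesOut (mid : List ℕ) (css : List (List ℕ)) (c : ℕ) :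
    (clausesOut mid pos neg q css c).length = c * mid.length :=
  length_flatMap_range (by simp) c

theorem clausesOut_succ (mid : List ℕ) (css : List (List ℕ)) (c : ℕ) :
    clausesOut mid pos neg q css (c + 1) = clausesOut mid pos neg q css c ++
      mid.map (env (q + c) (clauseBit pos neg (css.getD c []))) := by
  simp [clausesOut, List.range_succ]

/-- One round of `pass`: go through all the clauses for a fixed half assignment. -/
def halfStep (g : ℕ) (pre mid post : List ℕ) : Program :=
  .seq (.seq (.arith .sub rTrue rHalves rOne) <| .seq (.arith .sub rFalse rA rHalves) <|
    .seq (.arith .mul rTrue rTrue g) <| .seq (.arith .mul rFalse rFalse g) <|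
    .seq (.const rPos 2) (.arith .add rClauses rM rZero)) <|
  .seq (emit pre) <| .seq (times rClauses (clauseStep mid)) <|
  .seq (emit post) (.arith .add rState rState rOne)

theorem times_clauseStep_spec {css : List (List ℕ)} {u v mid : List ℕ}
    (h : Ready m A tab b l s) (hm : css.length = m) (hu : u.length = 2)
    (hl : l = u ++ clausesCode css ++ v) (hB : 2 ≤ B) (hlB : l.length + m * mid.length ≤ B)
    (hpos : s.reg rPos = 2) (hcs : ∀ cs ∈ css, cs.length ≤ k ∧ ∀ x ∈ cs, Covers B tab l x)
    (hmid : ∀ r ∈ mid, r ∈ [rZero, rOne, rTwo, rState, rNext, rVal, rTarget])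
    (htrue : s.reg rTrue = pos) (hfalse : s.reg rFalse = neg) (hposB : pos ≤ B) (hnegB : neg ≤ B)
    (hq : s.reg rState = q) (hqB : q + m ≤ B) (hr : s.reg rClauses = m) :
    ∃ s', Runs B (times rClauses (clauseStep mid)) s s'
        (m * (k * 15 + 2 * mid.length + 12) + 1) ∧
      Ready m A tab b (l ++ clausesOut mid pos neg q css m) s' ∧ s'.reg rState = q + m := by
  obtain ⟨s', e, h', -, hq', -⟩ := Runs.times (B := B) (r := rClauses) (N := m)
    (n := k * 15 + 2 * mid.length + 10) (P := clauseStep mid)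
    (fun c s => Ready m A tab b (l ++ clausesOut mid pos neg q css c) s ∧
      s.reg rPos = 2 + (clausesCode (css.take c)).length ∧ s.reg rState = q + c ∧
      s.reg rTrue = pos ∧ s.reg rFalse = neg)
    (by omega) (by omega) (by decide)
    (by
      rintro c hc s ⟨h, hpos, hq, htrue, hfalse⟩ hr h1
      have hc' : c < css.length := by omega
      obtain ⟨hk, hcov⟩ := hcs css[c] (List.getElem_mem hc')
      have hmul : (c + 1) * mid.length ≤ m * mid.length := Nat.mul_le_mul_right _ hc
      rw [Nat.succ_mul] at hmul
      obtain ⟨s', e, h', hp', hs'⟩ := clauseStep_spec (B := B) (k := k) (mid := mid)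
        (u := u ++ clausesCode (css.take c)) (cs := css[c])
        (v := clausesCode (css.drop (c + 1)) ++ v ++ clausesOut mid pos neg q css c) h
        (by rw [hl, clausesCode_split css hc']; simp) hB
        (by rw [List.length_append, length_clausesOut]; omega)
        (by rw [hpos, List.length_append, hu]) (fun x hx => (hcov x hx).append _) hk hmid htrue
        hfalse hposB hnegB hq (by omega)
      have hkeep : ∀ r, r ∉ clauseEval.writes ++ [rNext, rTarget, rOut, rState] →
          s'.reg r = s.reg r := fun r hr => e.reg_eq fun hr' => hr (mem_writes_clauseStep hr')
      refine ⟨s', e, ?_, h'.one, ?_, ?_, ?_, ?_, ?_⟩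
      · rw [hkeep _ (by decide), hr]
      · rw [clausesOut_succ, ← List.append_assoc, List.getD_eq_getElem _ _ hc']
        exact h'.setReg (by decide)
      · simp only [State.setReg]
        rw [Function.update_of_ne (by decide), hp', List.take_succ_eq_append_getElem hc',
          clausesCode_append, clausesCode_cons]
        simp only [clausesCode, List.flatMap_nil, List.length_append, List.length_cons,
          List.append_nil, hu]
        omega
      · simpa [State.setReg, Nat.add_assoc] using hs'
      · simpa [State.setReg, htrue] using hkeep rTrue (by decide)
      · simpa [State.setReg, hfalse] using hkeep rFalse (by decide))
    (s := s) ⟨by simpa [clausesOut] using h, by simp [clausesCode, hpos], by simp [hq], htrue, hfalse⟩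
    hr h.one
  exact ⟨s', e, h', hq'⟩

/-- What `halfStep` writes down in round `i`. -/
def halfOut (pre mid post : List ℕ) (A g : ℕ) (css : List (List ℕ)) (i : ℕ) : List ℕ :=
  pre.map (env (2 + i * (css.length + 1)) 0) ++
  clausesOut mid ((A - 1 - i) * g) (i * g) (2 + i * (css.length + 1)) css css.length ++
  post.map (env (2 + i * (css.length + 1) + css.length) 0)

theorem Ready.env_eq (h : Ready m A tab b l s) (hq : s.reg rState = q) {rs : List ℕ}
    (hrs : ∀ r ∈ rs, r ∈ [rZero, rOne, rTwo, rState]) : ∀ r ∈ rs, s.reg r = env q 0 r := by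
  intro r hr
  have := hrs r hr
  simp only [List.mem_cons, List.not_mem_nil, or_false] at this
  rcases this with rfl | rfl | rfl | rfl <;> simp [env, h.zero, h.one, h.two, hq]

theorem env_zero_le (hB : 2 ≤ B) (hq : q + 1 ≤ B) (r : ℕ) : env q 0 r ≤ B := by
  unfold env
  split_ifs <;> omega

theorem mem_writes_halfStep {g : ℕ} {pre mid post : List ℕ} {r : ℕ}
    (h : r ∈ (halfStep g pre mid post).writes) :
    r ∈ clauseEval.writes ++ [rNext, rTarget, rOut, rState, rTrue, rFalse, rClauses] := by
  simp only [halfStep, times, Program.writes, List.mem_append, List.mem_cons, List.not_mem_nil,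
    or_false] at h
  rcases h with (h | h | h | h | h | h) | h | (h | h) | h | h
  all_goals first
    | (subst h; decide)
    | (rw [writes_emit _ _ h]; decide)
    | (have := mem_writes_clauseStep h
       rw [List.mem_append] at this ⊢
       exact this.imp_right fun hr => by simp at hr ⊢; tauto)

theorem halfStep_spec {g i gv : ℕ} {css : List (List ℕ)} {u v pre mid post : List ℕ}
    (h : Ready m A tab b l s) (hm : css.length = m) (hu : u.length = 2)
    (hl : l = u ++ clausesCode css ++ v) (hB : 2 ≤ B)
    (hlB : l.length + (pre.length + m * mid.length + post.length) ≤ B)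
    (hcs : ∀ cs ∈ css, cs.length ≤ k ∧ ∀ x ∈ cs, Covers B tab l x)
    (hpre : ∀ r ∈ pre, r ∈ [rZero, rOne, rTwo, rState])
    (hmid : ∀ r ∈ mid, r ∈ [rZero, rOne, rTwo, rState, rNext, rVal, rTarget])
    (hpost : ∀ r ∈ post, r ∈ [rZero, rOne, rTwo, rState])
    (hg : g = rOne ∨ g = rA) (hgv : s.reg g = gv) (hgA : gv ≤ A) (hAB : A * A ≤ B)
    (hq : s.reg rState = 2 + i * (m + 1)) (hqB : 2 + A * (m + 1) ≤ B) (hi : i < A)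
    (hr : s.reg rHalves = A - i) :
    ∃ s', Runs B (halfStep g pre mid post) s s'
        (2 * pre.length + m * (k * 15 + 2 * mid.length + 12) + 2 * post.length + 10) ∧
      Ready m A tab b (l ++ halfOut pre mid post A gv css i) s' ∧
      s'.reg rState = 2 + (i + 1) * (m + 1) := by
  have hqle : 2 + i * (m + 1) + m + 1 ≤ B := by
    have : (i + 1) * (m + 1) ≤ A * (m + 1) := Nat.mul_le_mul_right _ hi
    rw [Nat.succ_mul] at this
    omega
  have hAA : A ≤ A * A := Nat.le_mul_self A
  have hposA : (A - 1 - i) * gv ≤ B :=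
    (Nat.mul_le_mul (by omega : A - 1 - i ≤ A) hgA).trans hAB
  have hnegA : i * gv ≤ B := (Nat.mul_le_mul hi.le hgA).trans hAB
  have hmB : m ≤ B := by omega
  have hsub : A - i - 1 = A - 1 - i := by omega
  have hsub' : A - (A - i) = i := by omega
  let P₁ : Program := .seq (.arith .sub rTrue rHalves rOne) <| .seq (.arith .sub rFalse rA rHalves) <|
    .seq (.arith .mul rTrue rTrue g) <| .seq (.arith .mul rFalse rFalse g) <|
    .seq (.const rPos 2) (.arith .add rClauses rM rZero)
  obtain ⟨s₁, e₁, hm₁, ht₁, hf₁, hp₁, hc₁⟩ : ∃ s', Runs B P₁ s s' 6 ∧ s'.mem = s.mem ∧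
      s'.reg rTrue = (A - 1 - i) * gv ∧ s'.reg rFalse = i * gv ∧ s'.reg rPos = 2 ∧
      s'.reg rClauses = m := by
    have hg1 : (g = rOne ∧ gv = 1) ∨ (g = rA ∧ gv = A) :=
      hg.imp (fun e => ⟨e, by rw [← hgv, e, h.one]⟩) (fun e => ⟨e, by rw [← hgv, e, h.A]⟩)
    refine ⟨_, Runs.straight rfl s ?_, rfl, ?_, ?_, ?_, ?_⟩ <;>
      rcases hg1 with ⟨rfl, rfl⟩ | ⟨rfl, rfl⟩ <;>
      simp [P₁, Program.Bounded, Program.run, ArithOp.eval, h.one, h.A, h.m, h.zero, hr, hsub,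
        hsub'] <;>
      omega
  have h₁ := h.of_runs_of_mem_eq e₁
    (show ∀ r ∈ [rTrue, rFalse, rTrue, rFalse, rPos, rClauses], 19 ≤ r ∧ r % 2 = 1 by decide) hm₁
  have hq₁ : s₁.reg rState = 2 + i * (m + 1) := by
    rw [e₁.reg_eq (by simp [P₁, Program.writes]), hq]
  have henv₁ := h₁.env_eq hq₁ hpre
  obtain ⟨s₂, e₂, h₂, hk₂⟩ := h₁.emit (B := B) pre (fun hr => absurd (hpre _ hr) (by decide))
    (by omega) (by omega) fun r hr => by
      rw [henv₁ r hr]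
      exact env_zero_le hB (by omega) r
  rw [List.map_congr_left henv₁] at h₂
  obtain ⟨s₃, e₃, h₃, hq₃⟩ := times_clauseStep_spec (B := B) (k := k) (css := css) (u := u)
    (mid := mid) h₂ hm hu (v := v ++ pre.map (env (2 + i * (m + 1)) 0))
    (by rw [hl]; simp only [List.append_assoc]) hB
    (by rw [List.length_append, List.length_map]; omega) (by rw [hk₂ _ (by decide), hp₁])
    (fun cs hcs' => ⟨(hcs cs hcs').1, fun x hx => ((hcs cs hcs').2 x hx).append _⟩) hmid
    (by rw [hk₂ _ (by decide), ht₁]) (by rw [hk₂ _ (by decide), hf₁]) hposA hnegA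
    (by rw [hk₂ _ (by decide), hq₁]) (by omega) (by rw [hk₂ _ (by decide), hc₁])
  have henv₃ := h₃.env_eq hq₃ hpost
  obtain ⟨s₄, e₄, h₄, hk₄⟩ := h₃.emit (B := B) post (fun hr => absurd (hpost _ hr) (by decide))
    (by simp only [List.length_append, length_clausesOut, List.length_map]; omega) (by omega)
    fun r hr => by
      rw [henv₃ r hr]
      exact env_zero_le hB (by omega) r
  rw [List.map_congr_left henv₃] at h₄
  have hq₄ : s₄.reg rState = 2 + i * (m + 1) + m := by rw [hk₄ _ (by decide), hq₃]
  have e₅ := Runs.arith (B := B) (op := .add) (r := rState) (s := s₄) (a := rState) (b := rOne)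
    (by omega) (by rw [h₄.one]; omega)
  refine ⟨_, (e₁.seq (e₂.seq (e₃.seq (e₄.seq e₅)))).mono (by omega), ?_, ?_⟩
  · simp only [halfOut, hm, ← List.append_assoc]
    exact h₄.setReg (by decide)
  · simp only [State.setReg, ArithOp.eval, hq₄, h₄.one, Function.update_self]
    ring

/-- Go through all the half assignments and all the clauses, and write down the registers in the list
`pre` before the clauses of each half assignment, those in `mid` for each clause, and those in `post`
after the clauses. In round `i` the set bits of `i` are the false variables, and the other bits are
the true ones; both bit sets are multiplied by register `g`, which is `1` for the left half of the
variables and shifts the bit sets to the right half if it holds the number of half assignments. -/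
def pass (g : ℕ) (pre mid post : List ℕ) : Program :=
  .seq (.arith .add rHalves rA rZero) <| .seq (.const rState 2) <|
  times rHalves (halfStep g pre mid post)

/-- What `pass` writes down. -/
def passOut (pre mid post : List ℕ) (A g : ℕ) (css : List (List ℕ)) : List ℕ :=
  (List.range A).flatMap (halfOut pre mid post A g css)

theorem length_halfOut (pre mid post : List ℕ) (g : ℕ) (css : List (List ℕ)) (i : ℕ) :
    (halfOut pre mid post A g css i).length =
      pre.length + css.length * mid.length + post.length := by
  simp only [halfOut, List.length_append, List.length_map, length_clausesOut]

theorem pass_spec {g gv : ℕ} {css : List (List ℕ)} {u v pre mid post : List ℕ}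
    (h : Ready m A tab b l s) (hm : css.length = m) (hu : u.length = 2)
    (hl : l = u ++ clausesCode css ++ v) (hB : 2 ≤ B)
    (hlB : l.length + A * (pre.length + m * mid.length + post.length) ≤ B)
    (hcs : ∀ cs ∈ css, cs.length ≤ k ∧ ∀ x ∈ cs, Covers B tab l x)
    (hpre : ∀ r ∈ pre, r ∈ [rZero, rOne, rTwo, rState])
    (hmid : ∀ r ∈ mid, r ∈ [rZero, rOne, rTwo, rState, rNext, rVal, rTarget])
    (hpost : ∀ r ∈ post, r ∈ [rZero, rOne, rTwo, rState])
    (hg : g = rOne ∧ gv = 1 ∨ g = rA ∧ gv = A) (hA1 : 1 ≤ A) (hAB : A * A ≤ B)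
    (hqB : 2 + A * (m + 1) ≤ B) :
    ∃ s', Runs B (pass g pre mid post) s s'
        (A * (2 * pre.length + m * (k * 15 + 2 * mid.length + 12) + 2 * post.length + 12) + 3) ∧
      Ready m A tab b (l ++ passOut pre mid post A gv css) s' := by
  have hAA : A ≤ A * A := Nat.le_mul_self A
  have e₁ := Runs.arith (B := B) (op := .add) (r := rHalves) (s := s) (a := rA) (b := rZero)
    (by rw [h.A]; omega) (by rw [h.zero]; omega)
  rw [ArithOp.eval, h.A, h.zero, Nat.add_zero] at e₁
  have e₂ := Runs.const (B := B) (r := rState) (c := 2) (s := s.setReg rHalves A) hB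
  have h₂ : Ready m A tab b l ((s.setReg rHalves A).setReg rState 2) :=
    (h.setReg (by decide)).setReg (by decide)
  obtain ⟨s', e₃, h', -⟩ := Runs.times (B := B) (r := rHalves) (N := A)
    (n := 2 * pre.length + m * (k * 15 + 2 * mid.length + 12) + 2 * post.length + 10)
    (P := halfStep g pre mid post)
    (fun i s => Ready m A tab b (l ++ (List.range i).flatMap (halfOut pre mid post A gv css)) s ∧
      s.reg rState = 2 + i * (m + 1))
    (by omega) (by omega) (by decide)
    (by
      rintro i hi s ⟨h, hq⟩ hr -
      have hmul : (i + 1) * (pre.length + m * mid.length + post.length) ≤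
        A * (pre.length + m * mid.length + post.length) := Nat.mul_le_mul_right _ hi
      rw [Nat.succ_mul] at hmul
      obtain ⟨s', e, h', hq'⟩ := halfStep_spec (B := B) (k := k) (css := css) (u := u) (pre := pre)
        (mid := mid) (post := post) (g := g) (gv := gv) (i := i)
        (v := v ++ (List.range i).flatMap (halfOut pre mid post A gv css)) h hm hu
        (by rw [hl]; simp only [List.append_assoc]) hB
        (by
          rw [List.length_append, length_flatMap_range (length_halfOut _ _ _ _ _), hm]
          omega)
        (fun cs hcs' => ⟨(hcs cs hcs').1, fun x hx => ((hcs cs hcs').2 x hx).append _⟩)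
        hpre hmid hpost (hg.imp And.left And.left)
        (by rcases hg with ⟨rfl, rfl⟩ | ⟨rfl, rfl⟩; exacts [h.one, h.A])
        (by rcases hg with ⟨rfl, rfl⟩ | ⟨rfl, rfl⟩ <;> omega) hAB hq hqB hi hr
      refine ⟨s', e, ?_, h'.one, ?_, ?_⟩
      · rw [e.reg_eq fun hr => absurd (mem_writes_halfStep hr) (by decide), hr]
      · rw [List.range_succ, List.flatMap_append, ← List.append_assoc, List.flatMap_singleton]
        exact h'.setReg (by decide)
      · simpa [State.setReg] using hq')
    (s := (s.setReg rHalves A).setReg rState 2) ⟨by simpa using h₂, by simp [State.setReg]⟩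
    (by simp [State.setReg]) h₂.one
  exact ⟨s', (e₁.seq (e₂.seq e₃)).mono (Nat.le_of_eq (by ring)), h'⟩

end

/-! ### Preparing the registers and the table of powers of two -/

/-- Write down the table of powers of two, as many as register `rLits` says. -/
def powersTable : Program :=
  times rLits (.seq (emit [rVal]) (.arith .add rVal rVal rVal))

theorem powersTable_spec {B N : ℕ} {l : List ℕ} {s : State} (hone : s.reg rOne = 1)
    (hval : s.reg rVal = 1) (hout : s.reg rOut = l.length) (hmem : s.mem = memOf l)
    (hN : s.reg rLits = N) (hB : 1 ≤ B) (hlB : l.length + N ≤ B) (hpow : 2 ^ N ≤ 2 * B) :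
    ∃ s', Runs B powersTable s s' (N * 6 + 1) ∧
      s'.reg rOut = l.length + N ∧ s'.mem = memOf (l ++ (List.range N).map (2 ^ ·)) := by
  obtain ⟨s', e, h1, h2, -⟩ := Runs.times (B := B) (r := rLits) (N := N) (n := 4)
    (P := .seq (emit [rVal]) (.arith .add rVal rVal rVal))
    (fun i s => s.reg rOut = l.length + i ∧ s.mem = memOf (l ++ (List.range i).map (2 ^ ·)) ∧
      s.reg rVal = 2 ^ i)
    (by omega) hB (by decide)
    (by
      rintro i hi s ⟨hout, hmem, hval⟩ hr h1
      have hle : 2 ^ i ≤ B := by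
        have : 2 ^ (i + 1) ≤ 2 ^ N := Nat.pow_le_pow_right (by omega) hi
        rw [Nat.pow_succ] at this
        omega
      have e₁ := Runs.emit (B := B) [rVal] (by decide) (l ++ (List.range i).map (2 ^ ·)) s
        (by simp; omega) hB (by simpa [hval]) h1 (by simp [hout]) hmem
      have e₂ := Runs.arith (B := B) (op := .add) (r := rVal) (a := rVal) (b := rVal)
        (s := ⟨Function.update s.reg rOut ((l ++ (List.range i).map (2 ^ ·)).length + [rVal].length),
          memOf (l ++ (List.range i).map (2 ^ ·) ++ [rVal].map s.reg)⟩)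
        (by simpa [hval]) (by simpa [hval])
      refine ⟨_, e₁.seq e₂, by simp [State.setReg, hr], by simp [State.setReg, h1], ?_, ?_, ?_⟩
      · simp [State.setReg, Nat.add_assoc]
      · simp [State.setReg, hval, List.range_succ]
      · simp [State.setReg, hval, ArithOp.eval]
        ring)
    (s := s) ⟨hout, by simpa using hmem, by simpa using hval⟩ hN hone
  exact ⟨s', e, h1, h2⟩

/-- Prepare the registers, on formulas with at most `k` literals in each clause. The table of powers
of two is to be placed behind the longest such formula with the given number of clauses. -/
def setupRegs (k : ℕ) : Program :=
  .seq (.const rOne 1) <| .seq (.const rTwo 2) <| .seq (.load rX rZero) <|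
  .seq (.load rM rOne) <| .seq (.const rY (k + 1)) <| .seq (.arith .mul rY rM rY) <|
  .seq (.arith .add rOut rTwo rY) <| .seq (.arith .add rTab rOut rZero) <|
  .seq (.arith .add rX rX rOne) <| .seq (.arith .div rS rX rTwo) <|
  .seq (.arith .add rLits rS rS) <| .seq (.arith .add rLits rLits rOne) (.const rVal 1)

/-- Prepare the registers and the table of powers of two. -/
def setup (k : ℕ) : Program :=
  .seq (setupRegs k) <| .seq powersTable <|
  .seq (.arith .add rX rTab rS) <| .seq (.load rA rX) (.arith .add rBase rOut rZero)

/-- The contents of the memory after `setup`. -/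
def setupMem (k n : ℕ) (css : List (List ℕ)) : List ℕ :=
  n :: css.length :: clausesCode css ++
    List.replicate (css.length * (k + 1) - (clausesCode css).length) 0 ++
    (List.range (2 * ((n + 1) / 2) + 1)).map (2 ^ ·)

theorem length_clausesCode_le {k : ℕ} {css : List (List ℕ)} (h : ∀ cs ∈ css, cs.length ≤ k) :
    (clausesCode css).length ≤ css.length * (k + 1) := by
  induction css with
  | nil => simp [clausesCode]
  | cons cs css ih =>
    have := ih fun c hc => h c (List.mem_cons_of_mem _ hc)
    have := h cs List.mem_cons_self
    rw [clausesCode_cons, List.length_append, List.length_cons, List.length_cons, Nat.succ_mul]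
    omega

theorem length_setupMem {k : ℕ} (n : ℕ) {css : List (List ℕ)} (h : ∀ cs ∈ css, cs.length ≤ k) :
    (setupMem k n css).length = 2 + css.length * (k + 1) + (2 * ((n + 1) / 2) + 1) := by
  have := length_clausesCode_le h
  simp only [setupMem, List.length_append, List.length_cons, List.length_replicate, List.length_map,
    List.length_range]
  omega

theorem memOf_setupMem_table {k : ℕ} (n : ℕ) {css : List (List ℕ)} (h : ∀ cs ∈ css, cs.length ≤ k)
    {j : ℕ} (hj : j ≤ 2 * ((n + 1) / 2)) :
    memOf (setupMem k n css) (2 + css.length * (k + 1) + j) = 2 ^ j := by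
  have hle := length_clausesCode_le h
  have hlen : (n :: css.length :: clausesCode css ++
      List.replicate (css.length * (k + 1) - (clausesCode css).length) 0).length =
      2 + css.length * (k + 1) := by
    simp only [List.length_append, List.length_cons, List.length_replicate]
    omega
  rw [setupMem, ← hlen, memOf_append_right]
  simp [memOf, List.getElem?_range (show j < 2 * ((n + 1) / 2) + 1 by omega)]

theorem setup_spec {B k n : ℕ} {css : List (List ℕ)} (hk : ∀ cs ∈ css, cs.length ≤ k)
    (hlB : (setupMem k n css).length ≤ B) (hpow : 2 ^ (2 * ((n + 1) / 2)) ≤ B) (hkB : k + 1 ≤ B) :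
    ∃ s', Runs B (setup k) (init (n :: css.length :: clausesCode css)) s'
        ((2 * ((n + 1) / 2) + 1) * 6 + 17) ∧
      Ready css.length (2 ^ ((n + 1) / 2)) (2 + css.length * (k + 1)) (setupMem k n css).length
        (setupMem k n css) s' := by
  rw [length_setupMem n hk] at hlB
  set m := css.length with hm
  set h := (n + 1) / 2 with hh
  set s₀ := init (n :: m :: clausesCode css) with hs₀
  have hreg : s₀.reg = fun _ => 0 := rfl
  have hmem0 : s₀.mem 0 = n := rfl
  have hmem1 : s₀.mem 1 = m := rfl
  have hmk : m ≤ m * (k + 1) := Nat.le_mul_of_pos_right _ (by omega)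
  obtain ⟨s₁, e₁, hm₁, hone, htwo, hM, hout, htab, hS, hlits, hval⟩ :
      ∃ s', Runs B (setupRegs k) s₀ s' 13 ∧ s'.mem = s₀.mem ∧ s'.reg rOne = 1 ∧ s'.reg rTwo = 2 ∧
      s'.reg rM = m ∧ s'.reg rOut = 2 + m * (k + 1) ∧ s'.reg rTab = 2 + m * (k + 1) ∧
      s'.reg rS = h ∧ s'.reg rLits = 2 * h + 1 ∧ s'.reg rVal = 1 := by
    refine ⟨_, Runs.straight rfl s₀ ?_, rfl, ?_, ?_, ?_, ?_, ?_, ?_, ?_, ?_⟩ <;>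
      simp [setupRegs, Program.Bounded, Program.run, ArithOp.eval, hreg, hmem0, hmem1, ← hh] <;>
      omega
  have hpre : (n :: m :: clausesCode css ++
      List.replicate (m * (k + 1) - (clausesCode css).length) 0).length = 2 + m * (k + 1) := by
    have := length_clausesCode_le hk
    rw [← hm] at this
    simp only [List.length_append, List.length_cons, List.length_replicate]
    omega
  obtain ⟨s₂, e₂, hout₂, hm₂⟩ := powersTable_spec (B := B) (N := 2 * h + 1)
    (l := n :: m :: clausesCode css ++
      List.replicate (m * (k + 1) - (clausesCode css).length) 0) hone hval
    (by rw [hout, hpre]) (by rw [hm₁, memOf_append_replicate]; rfl) hlits (by omega)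
    (by rw [hpre]; omega) (by rw [Nat.pow_succ]; omega)
  have hmem₂ : s₂.mem = memOf (setupMem k n css) := hm₂
  have hlen := length_setupMem n hk
  rw [← hm, ← hh] at hlen
  rw [hpre, ← hlen] at hout₂
  have keep₂ : ∀ r, r ∉ [rOut, rVal, rLits] → s₂.reg r = s₁.reg r := fun r hr =>
    e₂.reg_eq (by simpa [powersTable, times, emit, Program.writes] using hr)
  have hA : s₂.mem (2 + m * (k + 1) + h) = 2 ^ h := by
    rw [hmem₂]
    exact memOf_setupMem_table n hk (by omega)
  have hzero : s₁.reg rZero = 0 := (e₁.reg_eq (by simp [setupRegs, Program.writes])).trans rfl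
  have hAB : 2 ^ h ≤ B := (Nat.pow_le_pow_right (by omega) (by omega)).trans hpow
  -- The number of half assignments is looked up in the table.
  obtain ⟨s₃, e₃, hm₃, hA₃, hbase₃⟩ : ∃ s', Runs B
      (.seq (.arith .add rX rTab rS) <| .seq (.load rA rX) (.arith .add rBase rOut rZero)) s₂ s' 3 ∧
      s'.mem = s₂.mem ∧ s'.reg rA = 2 ^ h ∧ s'.reg rBase = (setupMem k n css).length := by
    refine ⟨_, Runs.straight rfl s₂ ?_, rfl, ?_, ?_⟩ <;>
      simp [Program.Bounded, Program.run, ArithOp.eval, keep₂, hout₂, htab, hS, hA, hzero]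
    omega
  have keep₃ : ∀ r, r ∉ [rX, rA, rBase, rOut, rVal, rLits] → s₃.reg r = s₁.reg r := by
    intro r hr
    simp only [List.mem_cons, not_or] at hr
    rw [e₃.reg_eq (by simp [Program.writes]; tauto), keep₂ r (by simp; tauto)]
  refine ⟨s₃, (e₁.seq (e₂.seq e₃)).mono (by omega), ?_, hbase₃, ?_, ?_, ?_, ?_, hA₃, ?_, ?_, ?_⟩
  · intro r
    have hr : ∀ rs : List ℕ, (∀ x ∈ rs, x % 2 = 1) → 2 * r ∉ rs := fun rs hrs h => by
      have := hrs _ h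
      omega
    rw [keep₃ _ (hr _ (by decide)), e₁.reg_eq (hr (setupRegs 0).writes (by decide))]
    rfl
  · rw [keep₃ _ (by decide), hone]
  · rw [keep₃ _ (by decide), htwo]
  · rw [keep₃ _ (by decide), hzero]
  · rw [keep₃ _ (by decide), hM]
  · rw [keep₃ _ (by decide), htab]
  · rw [e₃.reg_eq (by decide), hout₂]
  · rw [hm₃, hmem₂]

/-! ### Writing down the automaton and running the given program -/

/-- Compute the sizes of the parts of the automaton: the number of states in `rY`, that of letters in
`rLits`, that of transitions in `rS`, and the length of the word in `rVal`. -/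
def sizes : Program :=
  .seq (.arith .add rX rM rOne) <| .seq (.arith .mul rX rA rX) <| .seq (.arith .add rY rX rTwo) <|
  .seq (.arith .add rS rX rX) <| .seq (.const rLits 6) <| .seq (.arith .add rS rS rLits) <|
  .seq (.const rLits 3) (.arith .add rVal rX rOne)

/-- The registers to be written down first: they hold the header, followed by the loops at the states
`0` and `1`. -/
def headerRegs : List ℕ :=
  [rY, rLits, rS, rOne, rVal,
    rZero, rZero, rZero, rZero, rOne, rZero, rZero, rTwo, rZero,
    rOne, rZero, rOne, rOne, rOne, rOne, rOne, rTwo, rOne]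

/-- Write down the automaton `ovInstance` below: the first pass yields the transitions, the second one
the word. -/
def writeNFA : Program :=
  .seq (.seq sizes (emit headerRegs)) <|
  .seq (pass rA [rZero, rTwo, rState] [rState, rOne, rNext, rState, rZero, rTarget]
    [rState, rTwo, rOne]) <|
  .seq (emit [rOne]) <| .seq (pass rOne [rTwo] [rVal] []) (emit [rTwo])

/-- What `writeNFA` writes down. -/
def nfaCode (A : ℕ) (css : List (List ℕ)) : List ℕ :=
  [A * (css.length + 1) + 2, 3, A * (css.length + 1) + A * (css.length + 1) + 6, 1,
    A * (css.length + 1) + 1, 0, 0, 0, 0, 1, 0, 0, 2, 0, 1, 0, 1, 1, 1, 1, 1, 2, 1] ++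
  passOut [rZero, rTwo, rState] [rState, rOne, rNext, rState, rZero, rTarget]
    [rState, rTwo, rOne] A A css ++ [1] ++ passOut [rTwo] [rVal] [] A 1 css ++ [2]

theorem length_passOut (pre mid post : List ℕ) (A g : ℕ) (css : List (List ℕ)) :
    (passOut pre mid post A g css).length =
      A * (pre.length + css.length * mid.length + post.length) :=
  length_flatMap_range (length_halfOut _ _ _ _ _) _

theorem writeNFA_spec {m A tab b B k : ℕ} {l : List ℕ} {s : State} {css : List (List ℕ)}
    {u v : List ℕ} (h : Ready m A tab b l s) (hm : css.length = m) (hu : u.length = 2)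
    (hl : l = u ++ clausesCode css ++ v) (hlB : l.length + 7 * (A * (m + 1)) + 25 ≤ B)
    (hcs : ∀ cs ∈ css, cs.length ≤ k ∧ ∀ x ∈ cs, Covers B tab l x)
    (hA1 : 1 ≤ A) (hAB : A * A ≤ B) :
    ∃ s', Runs B writeNFA s s' (A * ((m + 1) * (30 * k + 38)) + 70) ∧
      Ready m A tab b (l ++ nfaCode A css) s' := by
  have hexp : A * (m + 1) = A * m + A := Nat.mul_succ A m
  have hAm : m ≤ A * m := Nat.le_mul_of_pos_left _ hA1
  obtain ⟨s₁, e₁, hm₁, hY, hlits, hS, hval⟩ : ∃ s', Runs B sizes s s' 8 ∧ s'.mem = s.mem ∧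
      s'.reg rY = A * (m + 1) + 2 ∧ s'.reg rLits = 3 ∧
      s'.reg rS = A * (m + 1) + A * (m + 1) + 6 ∧ s'.reg rVal = A * (m + 1) + 1 := by
    refine ⟨_, Runs.straight rfl s ?_, rfl, ?_, ?_, ?_, ?_⟩ <;>
      simp [sizes, Program.Bounded, Program.run, ArithOp.eval, h.one, h.two, h.A, h.m]
    omega
  have h₁ := h.of_runs_of_mem_eq e₁ (by decide) hm₁
  have hmap₁ : headerRegs.map s₁.reg = [A * (m + 1) + 2, 3, A * (m + 1) + A * (m + 1) + 6, 1,
      A * (m + 1) + 1, 0, 0, 0, 0, 1, 0, 0, 2, 0, 1, 0, 1, 1, 1, 1, 1, 2, 1] := by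
    simp [headerRegs, hY, hlits, hS, hval, h₁.zero, h₁.one, h₁.two]
  obtain ⟨s₂, e₂, h₂, -⟩ := h₁.emit (B := B) headerRegs (by decide)
    (by simp only [headerRegs, List.length_cons, List.length_nil]; omega) (by omega)
    (by
      intro r hr
      have : s₁.reg r ∈ headerRegs.map s₁.reg := List.mem_map_of_mem hr
      rw [hmap₁] at this
      simp only [List.mem_cons, List.not_mem_nil, or_false] at this
      omega)
  rw [hmap₁] at h₂
  have hcs' : ∀ w, ∀ cs ∈ css, cs.length ≤ k ∧ ∀ x ∈ cs, Covers B tab (l ++ w) x :=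
    fun w cs hc => ⟨(hcs cs hc).1, fun x hx => ((hcs cs hc).2 x hx).append w⟩
  have hmul : ∀ c, A * (m * c) = A * m * c := fun c => (Nat.mul_assoc _ _ _).symm
  obtain ⟨s₃, e₃, h₃⟩ := pass_spec (B := B) (k := k) (g := rA) (gv := A) (u := u)
    (pre := [rZero, rTwo, rState]) (mid := [rState, rOne, rNext, rState, rZero, rTarget])
    (post := [rState, rTwo, rOne]) h₂ hm hu (by rw [hl, List.append_assoc]) (by omega)
    (by
      simp only [List.length_append, List.length_cons, List.length_nil, Nat.mul_add, hmul]
      omega)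
    (hcs' _) (by decide) (by decide) (by decide) (Or.inr ⟨rfl, rfl⟩) hA1 hAB (by omega)
  obtain ⟨s₄, e₄, h₄, -⟩ := h₃.emit (B := B) [rOne] (by decide)
    (by
      simp only [List.length_append, length_passOut, List.length_cons, List.length_nil,
        Nat.mul_add, hmul, hm]
      omega) (by omega) (by simp [h₃.one]; omega)
  simp only [List.map_cons, List.map_nil, h₃.one] at h₄
  obtain ⟨s₅, e₅, h₅⟩ := pass_spec (B := B) (k := k) (g := rOne) (gv := 1) (u := u)
    (pre := [rTwo]) (mid := [rVal]) (post := []) h₄ hm hu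
    (by rw [hl, List.append_assoc, List.append_assoc, List.append_assoc]) (by omega)
    (by
      simp only [List.length_append, length_passOut, List.length_cons, List.length_nil,
        Nat.mul_add, hmul, hm]
      omega)
    (by simpa only [List.append_assoc] using hcs' _)
    (by decide) (by decide) (by decide) (Or.inl ⟨rfl, rfl⟩) hA1 hAB (by omega)
  obtain ⟨s₆, e₆, h₆, -⟩ := h₅.emit (B := B) [rTwo] (by decide)
    (by
      simp only [List.length_append, length_passOut, List.length_cons, List.length_nil,
        Nat.mul_add, hmul, hm]
      omega) (by omega) (by simp [h₅.two]; omega)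
  simp only [List.map_cons, List.map_nil, h₅.two] at h₆
  refine ⟨s₆, ((e₁.seq e₂).seq (e₃.seq (e₄.seq (e₅.seq e₆)))).mono ?_, ?_⟩
  · have : A * m * k ≤ A * m * k + A * k := Nat.le_add_right _ _
    simp only [headerRegs, List.length_cons, List.length_nil]
    nlinarith
  · simpa only [nfaCode, hm, List.append_assoc] using h₆

/-- Reduce satisfiability to NFA acceptance, and run `P` on the automaton. -/
def satProgram (k : ℕ) (P : Program) : Program :=
  .seq (.seq (setup k) writeNFA) P.shift

/-- If `P` answers the question about the automaton in time `T`, then `satProgram k P` gives the same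
answer about the formula, in a time that is bounded in terms of the number `A` of half assignments,
and of the bit length of a bound `B` on all the numbers involved. -/
theorem satProgram_spec {k n B T : ℕ} {P : Program} {css : List (List ℕ)} {s : State}
    (hcs : ∀ cs ∈ css, cs.length ≤ k ∧ ∀ x ∈ cs, x < 2 * n)
    (hkB : k + 1 ≤ B) (hAB : 2 ^ ((n + 1) / 2) * 2 ^ ((n + 1) / 2) ≤ B) (hnB : 2 * n ≤ B)
    (hlB : (setupMem k n css).length + 7 * (2 ^ ((n + 1) / 2) * (css.length + 1)) + 25 ≤ B)
    (hP : Exec P (init (nfaCode (2 ^ ((n + 1) / 2)) css)) s T) :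
    ∃ s' t, Exec (satProgram k P) (init (n :: css.length :: clausesCode css)) s' t ∧
      s'.reg 0 = s.reg 0 ∧
      t ≤ ((2 * ((n + 1) / 2) + 1) * 6 +
        2 ^ ((n + 1) / 2) * ((css.length + 1) * (30 * k + 38)) + 87) * (2 * Nat.size B + 1) +
        T * (4 + 2 * Nat.size B) := by
  set h := (n + 1) / 2 with hh
  have hk : ∀ cs ∈ css, cs.length ≤ k := fun cs hc => (hcs cs hc).1
  have hpow : 2 ^ (2 * h) ≤ B := by rwa [Nat.two_mul, Nat.pow_add]
  obtain ⟨s₁, e₁, h₁⟩ := setup_spec hk (by omega) hpow hkB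
  obtain ⟨s₂, ⟨t, e₂, ht⟩, h₂⟩ := writeNFA_spec (B := B) (k := k) (u := [n, css.length])
    (v := List.replicate (css.length * (k + 1) - (clausesCode css).length) 0 ++
      (List.range (2 * h + 1)).map (2 ^ ·)) h₁ rfl rfl
    (by simp only [setupMem, List.cons_append, List.nil_append, List.append_assoc, ← hh]) hlB
    (fun cs hc => ⟨hk cs hc, fun x hx => by
      have hx := (hcs cs hc).2 x hx
      refine ⟨by omega, (Nat.pow_le_pow_right (by omega) (by omega)).trans hpow, ?_,
        memOf_setupMem_table n hk (by omega)⟩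
      rw [length_setupMem n hk]
      omega⟩) Nat.one_le_two_pow hAB
  obtain ⟨t₁, e₁, ht₁⟩ := e₁
  rw [← hh] at ht ht₁
  have hrep : Represents (setupMem k n css).length (init (nfaCode (2 ^ h) css)) s₂ :=
    ⟨h₂.even, h₂.base, fun i => by rw [h₂.mem, Nat.add_comm i, memOf_append_right]; rfl⟩
  obtain ⟨s₃, t₃, h₃, e₃, ht₃⟩ := hP.shift hrep
  refine ⟨s₃, _, .seq (.seq e₁ e₂) e₃, h₃.reg 0, ?_⟩
  have hsize : (setupMem k n css).length.size ≤ B.size := Nat.size_le_size (by omega)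
  have : T * (4 + 2 * (setupMem k n css).length.size) ≤ T * (4 + 2 * B.size) :=
    Nat.mul_le_mul_left _ (by omega)
  have e : ∀ x y : ℕ, (x + y + 87) * (2 * B.size + 1) =
      (x + 17) * (2 * B.size + 1) + (y + 70) * (2 * B.size + 1) := fun x y => by ring
  rw [e]
  omega

end LogRAM

/-! ### The automaton -/

theorem List.map_pmap_eq_self {α β : Type*} {p : α → Prop} {f : ∀ a, p a → β} {g : β → α}
    (h : ∀ a ha, g (f a ha) = a) (l : List α) (hl : ∀ a ∈ l, p a) : (l.pmap f hl).map g = l := by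
  rw [List.map_pmap]
  simp only [h]
  exact (List.pmap_eq_map hl).trans (List.map_id' l)

/-- The acceptance problem for an automaton with `n` states and `a` letters, all of which are given
as numbers. -/
def NFAInstance.ofNat (n a : ℕ) (hn : 0 < n) (T : List (ℕ × ℕ × ℕ)) (F w : List ℕ)
    (hT : ∀ e ∈ T, e.1 < n ∧ e.2.1 < a ∧ e.2.2 < n) (hT' : T.Nodup) (hF : ∀ q ∈ F, q < n)
    (hF' : F.Nodup) (hw : ∀ x ∈ w, x < a) : NFAInstance where
  numStates := n
  numStates_pos := hn
  numLetters := a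
  transitions := T.pmap (fun e h => (⟨e.1, h.1⟩, ⟨e.2.1, h.2.1⟩, ⟨e.2.2, h.2.2⟩)) hT
  transitions_nodup := hT'.pmap fun e _ e' _ h => by
    simp only [Prod.mk.injEq, Fin.mk.injEq] at h
    exact Prod.ext h.1 (Prod.ext h.2.1 h.2.2)
  finals := F.pmap Fin.mk hF
  finals_nodup := hF'.pmap fun q _ q' _ h => by simpa using h
  word := w.pmap Fin.mk hw

/-- `Reach T w q`: the automaton with transitions `T` can be in state `q` after reading `w`, which
lists the letters in reverse order. -/
def Reach (T : List (ℕ × ℕ × ℕ)) : List ℕ → ℕ → Prop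
  | [], q => q = 0
  | a :: w, q => ∃ p, Reach T w p ∧ (p, a, q) ∈ T

namespace NFAInstance

/-- The transitions as triples of numbers. -/
def transitionTriples (I : NFAInstance) : List (ℕ × ℕ × ℕ) :=
  I.transitions.map fun e => (e.1.val, e.2.1.val, e.2.2.val)

theorem mem_eval_iff_reach (I : NFAInstance) (x : List (Fin I.numLetters)) (q : Fin I.numStates) :
    q ∈ I.toNFA.eval x ↔ Reach I.transitionTriples (x.map Fin.val).reverse q.val := by
  induction x using List.reverseRecOn generalizing q with
  | nil =>
    show q = ⟨0, I.numStates_pos⟩ ↔ q.val = 0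
    rw [Fin.ext_iff]
  | append_singleton x b ih =>
    rw [NFA.eval_append_singleton, NFA.mem_stepSet, List.map_append, List.map_singleton,
      List.reverse_concat]
    constructor
    · rintro ⟨p, hp, hq⟩
      exact ⟨p.val, (ih p).1 hp, List.mem_map.2 ⟨_, hq, rfl⟩⟩
    · rintro ⟨p, hp, hq⟩
      obtain ⟨⟨p', b', q'⟩, he, h⟩ := List.mem_map.1 hq
      simp only [Prod.mk.injEq, Fin.val_inj] at h
      obtain ⟨rfl, rfl, rfl⟩ := h
      exact ⟨p', (ih p').2 hp, he⟩

theorem accepted_iff_reach (I : NFAInstance) : I.Accepted ↔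
    ∃ q ∈ I.finals.map Fin.val, Reach I.transitionTriples (I.word.map Fin.val).reverse q := by
  constructor
  · rintro ⟨q, hq, hr⟩
    exact ⟨q.val, List.mem_map_of_mem hq, (I.mem_eval_iff_reach _ q).1 hr⟩
  · rintro ⟨_, h, hr⟩
    obtain ⟨q, hq, rfl⟩ := List.mem_map.1 h
    exact ⟨q, hq, (I.mem_eval_iff_reach _ q).2 hr⟩

variable {n a : ℕ} {hn : 0 < n} {T : List (ℕ × ℕ × ℕ)} {F w : List ℕ}
  {hT : ∀ e ∈ T, e.1 < n ∧ e.2.1 < a ∧ e.2.2 < n} {hT' : T.Nodup} {hF : ∀ q ∈ F, q < n}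
  {hF' : F.Nodup} {hw : ∀ x ∈ w, x < a}

theorem transitionTriples_ofNat : (ofNat n a hn T F w hT hT' hF hF' hw).transitionTriples = T :=
  List.map_pmap_eq_self (fun _ _ => rfl) T hT

theorem map_finals_ofNat : (ofNat n a hn T F w hT hT' hF hF' hw).finals.map Fin.val = F :=
  List.map_pmap_eq_self (fun _ _ => rfl) F hF

theorem map_word_ofNat : (ofNat n a hn T F w hT hT' hF hF' hw).word.map Fin.val = w :=
  List.map_pmap_eq_self (fun _ _ => rfl) w hw

theorem encode_ofNat : (ofNat n a hn T F w hT hT' hF hF' hw).encode =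
    [n, a, T.length, F.length, w.length] ++ T.flatMap (fun e => [e.1, e.2.1, e.2.2]) ++ F ++ w := by
  have h : (ofNat n a hn T F w hT hT' hF hF' hw).transitions.flatMap
      (fun e => [e.1.val, e.2.1.val, e.2.2.val]) = T.flatMap (fun e => [e.1, e.2.1, e.2.2]) := by
    conv_rhs => rw [← transitionTriples_ofNat (hT := hT) (hn := hn) (hT' := hT') (hF := hF)
      (hF' := hF') (hw := hw), transitionTriples, List.flatMap_map]
  rw [encode, map_finals_ofNat, map_word_ofNat, h]
  simp [ofNat]

theorem accepted_ofNat : (ofNat n a hn T F w hT hT' hF hF' hw).Accepted ↔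
    ∃ q ∈ F, Reach T w.reverse q := by
  rw [accepted_iff_reach, transitionTriples_ofNat, map_finals_ofNat, map_word_ofNat]

end NFAInstance

/-- The number of the state in which it remains to compare the right half assignment `i` with the
clauses from the `c`-th on, if there are `m` clauses. -/
def stateOf (m i c : ℕ) : ℕ := 2 + i * (m + 1) + c

theorem stateOf_inj {m i c i' c' : ℕ} (hc : c ≤ m) (hc' : c' ≤ m)
    (h : stateOf m i c = stateOf m i' c') : i = i' ∧ c = c' := by
  have h' : c + (m + 1) * i = c' + (m + 1) * i' := by
    unfold stateOf at h
    rw [Nat.mul_comm (m + 1), Nat.mul_comm (m + 1)]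
    omega
  have hd := congrArg (· / (m + 1)) h'
  simp only [Nat.add_mul_div_left _ _ (Nat.succ_pos m), Nat.div_eq_of_lt (Nat.lt_succ_of_le hc),
    Nat.div_eq_of_lt (Nat.lt_succ_of_le hc'), Nat.zero_add] at hd
  subst hd
  exact ⟨rfl, by omega⟩

/-- The transitions for checking the right half assignment `i`. Here `R i c` is `1` if it satisfies
the clause `c`, and `0` otherwise. -/
def checkTransitions (m : ℕ) (R : ℕ → ℕ → ℕ) (i : ℕ) : List (ℕ × ℕ × ℕ) :=
  (0, 2, stateOf m i 0) :: (List.range m).flatMap (fun c =>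
    [(stateOf m i c, 1, stateOf m i c + 1), (stateOf m i c, 0, (stateOf m i c + 1) * R i c)]) ++
    [(stateOf m i m, 2, 1)]

/-- All the transitions. If a check fails, the automaton goes back to the initial state `0`; this does
no harm since it can be in that state at any time anyway. -/
def ovTransitions (A m : ℕ) (R : ℕ → ℕ → ℕ) : List (ℕ × ℕ × ℕ) :=
  [(0, 0, 0), (0, 1, 0), (0, 2, 0), (1, 0, 1), (1, 1, 1), (1, 2, 1)] ++
    (List.range A).flatMap (checkTransitions m R)

/-- The word that lists the values of all clauses under all left half assignments. -/
def ovWord (A m : ℕ) (W : ℕ → ℕ → ℕ) : List ℕ :=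
  (List.range A).flatMap (fun i => 2 :: (List.range m).map (W i)) ++ [2]

section

variable {A m : ℕ} {R W : ℕ → ℕ → ℕ}

theorem mem_checkTransitions {i : ℕ} {e : ℕ × ℕ × ℕ} : e ∈ checkTransitions m R i ↔
    e = (0, 2, stateOf m i 0) ∨ (∃ c < m, e = (stateOf m i c, 1, stateOf m i (c + 1)) ∨
      e = (stateOf m i c, 0, stateOf m i (c + 1) * R i c)) ∨ e = (stateOf m i m, 2, 1) := by
  simp [checkTransitions, stateOf, Nat.add_assoc]

theorem nodup_checkTransitions (i : ℕ) : (checkTransitions m R i).Nodup := by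
  rw [checkTransitions, List.cons_append, List.nodup_cons, List.nodup_append, List.nodup_flatMap]
  refine ⟨?_, ⟨?_, ?_⟩, List.nodup_singleton _, ?_⟩
  · simp [stateOf]
    omega
  · simp
  · refine (List.nodup_range (n := m)).imp fun {c c'} hne => ?_
    simp only [Function.onFun, List.disjoint_left, List.mem_cons, List.not_mem_nil, or_false]
    rintro e (rfl | rfl) (h | h) <;> simp [stateOf] at h <;> omega
  · simp [stateOf]
    rintro _ _ _ c _ (⟨_, rfl, _⟩ | ⟨_, rfl, _⟩) _ h <;> omega

theorem nodup_ovTransitions : (ovTransitions A m R).Nodup := by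
  rw [ovTransitions, List.nodup_append, List.nodup_flatMap]
  refine ⟨by decide, ⟨fun i _ => nodup_checkTransitions i, ?_⟩, ?_⟩
  · refine (List.nodup_range (n := A)).imp fun {i i'} hne => ?_
    -- A state of `checkTransitions` can be recovered from each transition in it.
    have key : ∀ i e, e ∈ checkTransitions m R i →
        ∃ c ≤ m, (if e.1 = 0 then e.2.2 else e.1) = stateOf m i c := by
      intro i e he
      rcases mem_checkTransitions.1 he with rfl | ⟨c, hc, rfl | rfl⟩ | rfl
      · exact ⟨0, Nat.zero_le _, rfl⟩
      · exact ⟨c, hc.le, if_neg (by simp [stateOf])⟩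
      · exact ⟨c, hc.le, if_neg (by simp [stateOf])⟩
      · exact ⟨m, le_rfl, if_neg (by simp [stateOf])⟩
    refine List.disjoint_left.2 fun e he he' => hne ?_
    obtain ⟨c, hc, h⟩ := key i e he
    obtain ⟨c', hc', h'⟩ := key i' e he'
    exact (stateOf_inj hc hc' (h.symm.trans h')).1
  · intro e he e' he' heq
    subst heq
    obtain ⟨i, -, hi⟩ := List.mem_flatMap.1 he'
    rcases mem_checkTransitions.1 hi with rfl | ⟨c, hc, rfl | rfl⟩ | rfl <;>
      simp [stateOf] at he <;> omega

theorem ovTransitions_lt (hR : ∀ i c, R i c ≤ 1) (e : ℕ × ℕ × ℕ) (he : e ∈ ovTransitions A m R) :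
    e.1 < A * (m + 1) + 2 ∧ e.2.1 < 3 ∧ e.2.2 < A * (m + 1) + 2 := by
  rw [ovTransitions, List.mem_append, List.mem_flatMap] at he
  rcases he with he | ⟨i, hi, he⟩
  · simp only [List.mem_cons, List.not_mem_nil, or_false] at he
    rcases he with rfl | rfl | rfl | rfl | rfl | rfl <;> simp
  · have hmul : (i + 1) * (m + 1) ≤ A * (m + 1) := Nat.mul_le_mul_right _ (List.mem_range.1 hi)
    rw [Nat.succ_mul] at hmul
    rcases mem_checkTransitions.1 he with rfl | ⟨c, hc, rfl | rfl⟩ | rfl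
    · simp only [stateOf]; omega
    · simp only [stateOf]; omega
    · have : stateOf m i (c + 1) * R i c ≤ stateOf m i (c + 1) * 1 := Nat.mul_le_mul_left _ (hR i c)
      simp only [stateOf] at this ⊢
      omega
    · simp only [stateOf]; omega

theorem length_ovTransitions : (ovTransitions A m R).length = A * (m + 1) + A * (m + 1) + 6 := by
  have h : ∀ i, (checkTransitions m R i).length = (m + 1) + (m + 1) := by
    intro i
    simp only [checkTransitions, List.length_append, List.length_cons, List.length_nil,
      LogRAM.length_flatMap_range (f := fun c => [(stateOf m i c, 1, stateOf m i c + 1),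
        (stateOf m i c, 0, (stateOf m i c + 1) * R i c)]) (a := 2) (fun _ => rfl)]
    omega
  rw [ovTransitions, List.length_append, LogRAM.length_flatMap_range h, Nat.mul_add]
  simp only [List.length_cons, List.length_nil]
  omega

theorem length_ovWord : (ovWord A m W).length = A * (m + 1) + 1 := by
  rw [ovWord, List.length_append, LogRAM.length_flatMap_range (a := m + 1) (by simp)]
  rfl

theorem ovWord_lt (hW : ∀ i c, W i c ≤ 1) (x : ℕ) (hx : x ∈ ovWord A m W) : x < 3 := by
  simp only [ovWord, List.mem_append, List.mem_flatMap, List.mem_cons, List.mem_map,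
    List.not_mem_nil, or_false] at hx
  rcases hx with ⟨i, _, rfl | ⟨c, _, rfl⟩⟩ | rfl
  · omega
  · have := hW i c; omega
  · omega

/-- The values `f c` for the clauses `c < n` are compatible with the right half assignment `i`. -/
def Compatible (R : ℕ → ℕ → ℕ) (i n : ℕ) (f : ℕ → ℕ) : Prop :=
  ∀ c < n, f c = 1 ∨ f c = 0 ∧ R i c = 1

/-- What the automaton knows about the word `w` it has read if it is in state `q`. -/
def Knows (A m : ℕ) (R : ℕ → ℕ → ℕ) (w : List ℕ) (q : ℕ) : Prop :=
  q = 0 ∨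
  (q = 1 ∧ ∃ i < A, ∃ u f v, w = u ++ 2 :: (List.range m).map f ++ 2 :: v ∧ Compatible R i m f) ∨
  ∃ i < A, ∃ c ≤ m, q = stateOf m i c ∧
    ∃ u f, w = u ++ 2 :: (List.range c).map f ∧ Compatible R i c f

theorem Knows.of_stateOf {w : List ℕ} {i c : ℕ} (h : Knows A m R w (stateOf m i c)) (hc : c ≤ m) :
    ∃ u f, w = u ++ 2 :: (List.range c).map f ∧ Compatible R i c f := by
  rcases h with h | ⟨h, -⟩ | ⟨i', _, c', hc', h, huf⟩
  · simp [stateOf] at h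
  · unfold stateOf at h; omega
  · obtain ⟨rfl, rfl⟩ := stateOf_inj hc hc' h
    exact huf

theorem Compatible.extend {i c a : ℕ} {u : List ℕ} {f : ℕ → ℕ} (h : Compatible R i c f)
    (ha : a = 1 ∨ a = 0 ∧ R i c = 1) :
    ∃ f', u ++ 2 :: (List.range c).map f ++ [a] = u ++ 2 :: (List.range (c + 1)).map f' ∧
      Compatible R i (c + 1) f' := by
  have hne : ∀ x < c, Function.update f c a x = f x := fun x hx => Function.update_of_ne hx.ne _ _
  refine ⟨Function.update f c a, ?_, fun x hx => ?_⟩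
  · rw [List.range_succ, List.map_append, List.map_singleton, Function.update_self,
      List.map_congr_left fun x hx => hne x (List.mem_range.1 hx)]
    simp
  · rcases Nat.lt_succ_iff_lt_or_eq.1 hx with hx | rfl
    · rw [hne x hx]
      exact h x hx
    · rwa [Function.update_self]

theorem Reach.knows (hR : ∀ i c, R i c ≤ 1) {w : List ℕ} {q : ℕ}
    (h : Reach (ovTransitions A m R) w q) : Knows A m R w.reverse q := by
  induction w generalizing q with
  | nil => exact Or.inl h
  | cons a w ih =>
    obtain ⟨p, hp, hT⟩ := h
    replace ih := ih hp
    rw [List.reverse_cons]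
    rw [ovTransitions, List.mem_append, List.mem_flatMap] at hT
    rcases hT with hT | ⟨i, hi, hT⟩
    · simp only [List.mem_cons, Prod.mk.injEq, List.not_mem_nil, or_false] at hT
      have hT' : q = 0 ∨ p = 1 ∧ q = 1 := by omega
      rcases hT' with rfl | ⟨rfl, rfl⟩
      · exact Or.inl rfl
      · rcases ih with h | ⟨-, i, hi, u, f, v, hw, hf⟩ | ⟨i, _, c, _, h, -⟩
        · omega
        · exact Or.inr (Or.inl ⟨rfl, i, hi, u, f, v ++ [a], by rw [hw]; simp, hf⟩)
        · unfold stateOf at h; omega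
    · have hi := List.mem_range.1 hi
      rcases mem_checkTransitions.1 hT with h | ⟨c, hc, h | h⟩ | h <;>
        simp only [Prod.mk.injEq] at h <;> obtain ⟨rfl, rfl, rfl⟩ := h
      · exact Or.inr (Or.inr ⟨i, hi, 0, Nat.zero_le _, rfl, w.reverse, fun _ => 0, rfl,
          fun c hc => absurd hc (Nat.not_lt_zero c)⟩)
      · obtain ⟨u, f, hw, hf⟩ := ih.of_stateOf hc.le
        rw [hw]
        exact Or.inr (Or.inr ⟨i, hi, c + 1, hc, rfl, u, hf.extend (Or.inl rfl)⟩)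
      · rcases Nat.le_one_iff_eq_zero_or_eq_one.1 (hR i c) with h0 | h1
        · exact Or.inl (by rw [h0, Nat.mul_zero])
        · obtain ⟨u, f, hw, hf⟩ := ih.of_stateOf hc.le
          rw [hw]
          exact Or.inr (Or.inr ⟨i, hi, c + 1, hc, by rw [h1, Nat.mul_one], u,
            hf.extend (Or.inr ⟨rfl, h1⟩)⟩)
      · obtain ⟨u, f, hw, hf⟩ := ih.of_stateOf le_rfl
        exact Or.inr (Or.inl ⟨rfl, i, hi, u, f, [], by rw [hw], hf⟩)

theorem reach_zero : ∀ w : List ℕ, (∀ x ∈ w, x < 3) → Reach (ovTransitions A m R) w 0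
  | [], _ => rfl
  | a :: w, h => by
    refine ⟨0, reach_zero w fun x hx => h x (List.mem_cons_of_mem _ hx), ?_⟩
    have ha := h a List.mem_cons_self
    interval_cases a <;> simp [ovTransitions]

theorem Reach.one_append {w : List ℕ} (hw : Reach (ovTransitions A m R) w 1) :
    ∀ v : List ℕ, (∀ x ∈ v, x < 3) → Reach (ovTransitions A m R) (v ++ w) 1
  | [], _ => hw
  | a :: v, h => by
    refine ⟨1, hw.one_append v fun x hx => h x (List.mem_cons_of_mem _ hx), ?_⟩
    have ha := h a List.mem_cons_self
    interval_cases a <;> simp [ovTransitions]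

theorem mem_ovTransitions_of_check {i : ℕ} {e : ℕ × ℕ × ℕ} (hi : i < A)
    (he : e ∈ checkTransitions m R i) : e ∈ ovTransitions A m R :=
  List.mem_append_right _ (List.mem_flatMap.2 ⟨i, List.mem_range.2 hi, he⟩)

theorem reach_stateOf {i : ℕ} (hi : i < A) {u : List ℕ} (hu : ∀ x ∈ u, x < 3) {f : ℕ → ℕ} :
    ∀ c ≤ m, Compatible R i c f →
      Reach (ovTransitions A m R) (((List.range c).map f).reverse ++ 2 :: u) (stateOf m i c)
  | 0, _, _ => ⟨0, reach_zero u hu,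
      mem_ovTransitions_of_check hi (mem_checkTransitions.2 (Or.inl rfl))⟩
  | c + 1, hc, hf => by
    rw [List.range_succ, List.map_append, List.reverse_append]
    refine ⟨_, reach_stateOf hi hu c (by omega) fun x hx => hf x (by omega),
      mem_ovTransitions_of_check hi (mem_checkTransitions.2 (Or.inr (Or.inl ⟨c, hc, ?_⟩)))⟩
    rcases hf c (by omega) with h | ⟨h, h'⟩
    · exact Or.inl (by rw [h])
    · exact Or.inr (by rw [h, h', Nat.mul_one])

/-- The words that are accepted are those in which one of the blocks between consecutive letters
`2` is compatible with some right half assignment. -/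
theorem reach_one_iff (hR : ∀ i c, R i c ≤ 1) {w : List ℕ} (hw : ∀ x ∈ w, x < 3) :
    Reach (ovTransitions A m R) w.reverse 1 ↔
      ∃ i < A, ∃ u f v, w = u ++ 2 :: (List.range m).map f ++ 2 :: v ∧ Compatible R i m f := by
  constructor
  · intro h
    have := h.knows hR
    rw [List.reverse_reverse] at this
    rcases this with h | ⟨-, h⟩ | ⟨i, _, c, _, h, -⟩
    · omega
    · exact h
    · unfold stateOf at h; omega
  · rintro ⟨i, hi, u, f, v, rfl, hf⟩
    have h := reach_stateOf hi (u := u.reverse) (fun x hx => hw x (by simp at hx; simp [hx])) m le_rfl hf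
    have h1 : Reach (ovTransitions A m R) (2 :: (((List.range m).map f).reverse ++ 2 :: u.reverse)) 1 :=
      ⟨_, h, mem_ovTransitions_of_check hi (mem_checkTransitions.2 (Or.inr (Or.inr rfl)))⟩
    have := h1.one_append v.reverse fun x hx => hw x (by simp at hx; simp [hx])
    simpa using this

theorem flatMap_separated_eq {ι : Type*} (g : ι → List ℕ) (L : List ι) :
    ∃ r, L.flatMap (fun i => 2 :: g i) ++ [2] = 2 :: r := by
  cases L with
  | nil => exact ⟨[], rfl⟩
  | cons i L => exact ⟨_, rfl⟩

/-- The blocks between consecutive separators are the ones that the list was composed of. -/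
theorem flatMap_separated_iff {ι : Type*} {g : ι → List ℕ} (hg : ∀ i, 2 ∉ g i) {x : List ℕ}
    (hx : 2 ∉ x) (L : List ι) :
    (∃ u v, L.flatMap (fun i => 2 :: g i) ++ [2] = u ++ 2 :: x ++ 2 :: v) ↔ ∃ i ∈ L, g i = x := by
  constructor
  · rintro ⟨u, v, h⟩
    induction L generalizing u with
    | nil =>
      have := congrArg List.length h
      simp at this
      omega
    | cons i L ih =>
      obtain ⟨r, hr⟩ := flatMap_separated_eq g L
      rw [List.flatMap_cons, List.append_assoc, List.append_assoc, List.cons_append] at h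
      cases u with
      | nil =>
        rw [hr, List.nil_append, List.cons_append, List.cons.injEq] at h
        refine ⟨i, List.mem_cons_self, ?_⟩
        rcases List.append_eq_append_iff.1 h.2 with ⟨c, hc, hc'⟩ | ⟨c, hc, hc'⟩ <;> cases c
        · simpa using hc.symm
        · simp only [List.cons_append, List.cons.injEq] at hc'
          exact absurd (by rw [hc, ← hc'.1]; simp) hx
        · simpa using hc
        · simp only [List.cons_append, List.cons.injEq] at hc'
          exact absurd (by rw [hc, ← hc'.1]; simp) (hg i)
      | cons a u =>
        rw [List.cons_append, List.cons.injEq] at h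
        have hsuf : ∃ u', L.flatMap (fun i => 2 :: g i) ++ [2] = u' ++ 2 :: x ++ 2 :: v := by
          rcases List.append_eq_append_iff.1 h.2 with ⟨c, hc, hc'⟩ | ⟨c, hc, hc'⟩
          · exact ⟨c, by rw [hc', List.append_assoc]⟩
          · cases c with
            | nil => exact ⟨[], by simpa using hc'.symm⟩
            | cons b c =>
              simp only [List.cons_append, List.cons.injEq] at hc'
              exact absurd (by rw [hc, ← hc'.1]; simp) (hg i)
        obtain ⟨u', hu'⟩ := hsuf
        obtain ⟨j, hj, hjx⟩ := ih u' hu'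
        exact ⟨j, List.mem_cons_of_mem _ hj, hjx⟩
  · rintro ⟨i, hi, rfl⟩
    obtain ⟨L₁, L₂, rfl⟩ := List.append_of_mem hi
    obtain ⟨r, hr⟩ := flatMap_separated_eq g L₂
    refine ⟨L₁.flatMap (fun i => 2 :: g i), r, ?_⟩
    rw [List.flatMap_append, List.flatMap_cons, List.append_assoc, List.append_assoc, hr,
      List.append_assoc]

/-- The automaton that looks for a left and a right half assignment which together satisfy all
clauses. -/
def ovInstance (A m : ℕ) (W R : ℕ → ℕ → ℕ) (hW : ∀ i c, W i c ≤ 1) (hR : ∀ i c, R i c ≤ 1) :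
    NFAInstance :=
  .ofNat (A * (m + 1) + 2) 3 (by omega) (ovTransitions A m R) [1] (ovWord A m W)
    (ovTransitions_lt hR) nodup_ovTransitions (by simp) (List.nodup_singleton 1) (ovWord_lt hW)

theorem accepted_ovInstance (hW : ∀ i c, W i c ≤ 1) (hR : ∀ i c, R i c ≤ 1) :
    (ovInstance A m W R hW hR).Accepted ↔
      ∃ i < A, ∃ j < A, ∀ c < m, W i c = 1 ∨ R j c = 1 := by
  rw [ovInstance, NFAInstance.accepted_ofNat]
  simp only [List.mem_singleton, exists_eq_left]
  rw [reach_one_iff hR (ovWord_lt hW)]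
  have hblock : ∀ i, 2 ∉ (List.range m).map (W i) := fun i h => by
    obtain ⟨c, -, hc⟩ := List.mem_map.1 h
    have := hW i c
    omega
  constructor
  · rintro ⟨j, hj, u, f, v, hw, hf⟩
    have hx : 2 ∉ (List.range m).map f := fun h => by
      obtain ⟨c, hc, hc'⟩ := List.mem_map.1 h
      have := hf c (List.mem_range.1 hc)
      omega
    obtain ⟨i, hi, hif⟩ := (flatMap_separated_iff hblock hx _).1 ⟨u, v, hw⟩
    refine ⟨i, List.mem_range.1 hi, j, hj, fun c hc => ?_⟩
    rw [List.map_inj_left.1 hif c (List.mem_range.2 hc)]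
    exact (hf c hc).imp_right And.right
  · rintro ⟨i, hi, j, hj, h⟩
    obtain ⟨u, v, hw⟩ := (flatMap_separated_iff hblock (hblock i) _).2 ⟨i, List.mem_range.2 hi, rfl⟩
    refine ⟨j, hj, u, W i, v, hw, fun c hc => ?_⟩
    have := hW i c
    have := h c hc
    omega

theorem sparse_ovInstance (hW : ∀ i c, W i c ≤ 1) (hR : ∀ i c, R i c ≤ 1) :
    (ovInstance A m W R hW hR).Sparse 3 := by
  refine ⟨le_rfl, ?_, ?_⟩
  · simp only [ovInstance, NFAInstance.ofNat, List.length_pmap, length_ovTransitions]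
    omega
  · simp only [ovInstance, NFAInstance.ofNat, List.length_pmap, length_ovWord]
    omega

end

/-! ### Satisfiability in terms of half assignments -/

open LogRAM

theorem clauseBit_eq_one_iff {pos neg : ℕ} {cs : List ℕ} :
    clauseBit pos neg cs = 1 ↔ ∃ x ∈ cs, litBit pos neg x = 1 := by
  rw [clauseBit]
  constructor
  · intro h
    by_contra! hne
    rw [if_pos (List.sum_eq_zero fun y hy => by
      obtain ⟨x, hx, rfl⟩ := List.mem_map.1 hy
      have := litBit_le_one pos neg x
      have := hne x hx
      omega)] at h
    omega
  · rintro ⟨x, hx, h1⟩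
    have := List.le_sum_of_mem (List.mem_map_of_mem (f := litBit pos neg) hx)
    rw [if_neg (by omega)]

/-- The partial assignment with number `i` concerns the `h` variables from the `o`-th on, and makes
those false for which `i` has a bit `1`. -/
theorem litBit_half_eq_one_iff {h i o v : ℕ} (hi : i < 2 ^ h) (s : Bool) :
    litBit ((2 ^ h - 1 - i) * 2 ^ o) (i * 2 ^ o) (2 * v + s.toNat) = 1 ↔
      o ≤ v ∧ v - o < h ∧ s = !i.testBit (v - o) := by
  have hsub : 2 ^ h - 1 - i = 2 ^ h - (i + 1) := by omega
  have hbit : ∀ x, x / 2 ^ v % 2 = 1 ↔ x.testBit v = true := fun x => by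
    rw [Nat.testBit_eq_decide_div_mod_eq, decide_eq_true_iff]
  have hlt : i.testBit (v - o) = true → v - o < h := fun hb => by
    by_contra hge
    rw [Nat.testBit_lt_two_pow (hi.trans_le (Nat.pow_le_pow_right (by omega) (not_lt.1 hge)))] at hb
    exact absurd hb (by decide)
  rw [litBit]
  cases s
  · rw [Bool.toNat_false, if_pos (by omega), show (2 * v + 0) / 2 = v by omega, hbit,
      Nat.testBit_mul_two_pow]
    cases hb : i.testBit (v - o) <;> simp_all
  · rw [Bool.toNat_true, if_neg (by omega), show (2 * v + 1) / 2 = v by omega, hbit,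
      Nat.testBit_mul_two_pow, hsub, Nat.testBit_two_pow_sub_succ hi]
    cases hb : i.testBit (v - o) <;> simp_all

namespace CNFFormula

/-- The clauses with their literals given as numbers. -/
def codes (φ : CNFFormula) : List (List ℕ) :=
  φ.clauses.map fun c => c.map fun l => 2 * l.1.val + l.2.toNat

theorem length_codes (φ : CNFFormula) : φ.codes.length = φ.clauses.length := List.length_map _

theorem encode_eq (φ : CNFFormula) :
    φ.encode = φ.numVars :: φ.codes.length :: clausesCode φ.codes := by
  simp [encode, codes, clausesCode, List.flatMap_map]

/-- The truth value of clause `c` under the half assignment number `i` of the `h` variables from the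
`o`-th on. -/
def halfValue (φ : CNFFormula) (h o i c : ℕ) : ℕ :=
  clauseBit ((2 ^ h - 1 - i) * 2 ^ o) (i * 2 ^ o) (φ.codes.getD c [])

theorem halfValue_eq_one_iff (φ : CNFFormula) {h o i c : ℕ} (hi : i < 2 ^ h)
    (hc : c < φ.clauses.length) : φ.halfValue h o i c = 1 ↔
      ∃ l ∈ φ.clauses[c], o ≤ l.1.val ∧ l.1.val - o < h ∧ l.2 = !i.testBit (l.1.val - o) := by
  have hget : φ.codes.getD c [] = φ.clauses[c].map fun l => 2 * l.1.val + l.2.toNat := by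
    rw [List.getD_eq_getElem _ _ (by rwa [length_codes])]
    simp [codes]
  rw [halfValue, clauseBit_eq_one_iff, hget]
  simp only [List.mem_map, exists_exists_and_eq_and, litBit_half_eq_one_iff hi]

theorem satisfiable_iff_halfValue (φ : CNFFormula) {h : ℕ} (hn : φ.numVars ≤ 2 * h) :
    φ.Satisfiable ↔ ∃ i < 2 ^ h, ∃ j < 2 ^ h, ∀ c < φ.clauses.length,
      φ.halfValue h 0 i c = 1 ∨ φ.halfValue h h j c = 1 := by
  constructor
  · rintro ⟨α, hα⟩
    let β : ℕ → Bool := fun v => if hv : v < φ.numVars then α ⟨v, hv⟩ else false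
    have hβ : ∀ v : Fin φ.numVars, β v.val = α v := fun v => dif_pos v.2
    let bits : ℕ → ℕ := fun o => Nat.ofBits fun v : Fin h => !β (o + v.val)
    have hbits : ∀ o, bits o < 2 ^ h := fun o => Nat.ofBits_lt_two_pow _
    have hbit : ∀ o v, v < h → (bits o).testBit v = !β (o + v) := fun o v hv => by
      rw [Nat.testBit_ofBits_lt _ _ hv]
    refine ⟨bits 0, hbits 0, bits h, hbits h, fun c hc => ?_⟩
    rw [halfValue_eq_one_iff φ (hbits 0) hc, halfValue_eq_one_iff φ (hbits h) hc]
    obtain ⟨l, hl, hlα⟩ := hα _ (List.getElem_mem hc)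
    have hln := l.1.2
    rcases lt_or_ge l.1.val h with hlt | hge
    · refine Or.inl ⟨l, hl, Nat.zero_le _, hlt, ?_⟩
      rw [hbit _ _ (by omega), Nat.zero_add, Nat.sub_zero, hβ, hlα, Bool.not_not]
    · refine Or.inr ⟨l, hl, hge, by omega, ?_⟩
      rw [hbit _ _ (by omega), Nat.add_sub_cancel' hge, hβ, hlα, Bool.not_not]
  · rintro ⟨i, hi, j, hj, hij⟩
    refine ⟨fun v => if v.val < h then !i.testBit v.val else !j.testBit (v.val - h), fun C hC => ?_⟩
    obtain ⟨c, hc, rfl⟩ := List.getElem_of_mem hC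
    rcases hij c hc with h1 | h1
    · obtain ⟨l, hl, -, hlt, hs⟩ := (halfValue_eq_one_iff φ hi hc).1 h1
      exact ⟨l, hl, (if_pos hlt).trans hs.symm⟩
    · obtain ⟨l, hl, hge, hlt, hs⟩ := (halfValue_eq_one_iff φ hj hc).1 h1
      exact ⟨l, hl, (if_neg (by omega)).trans hs.symm⟩

theorem halfValue_le_one (φ : CNFFormula) (h o i c : ℕ) : φ.halfValue h o i c ≤ 1 :=
  clauseBit_le_one _

/-- The automaton that accepts its word if and only if the formula is satisfiable. -/
def toNFAInstance (φ : CNFFormula) (h : ℕ) : NFAInstance :=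
  ovInstance (2 ^ h) φ.codes.length (φ.halfValue h 0) (φ.halfValue h h) (φ.halfValue_le_one h 0)
    (φ.halfValue_le_one h h)

theorem accepted_toNFAInstance (φ : CNFFormula) {h : ℕ} (hn : φ.numVars ≤ 2 * h) :
    (φ.toNFAInstance h).Accepted ↔ φ.Satisfiable := by
  rw [toNFAInstance, accepted_ovInstance, φ.satisfiable_iff_halfValue hn, length_codes]

theorem encode_toNFAInstance (φ : CNFFormula) (h : ℕ) :
    (φ.toNFAInstance h).encode = nfaCode (2 ^ h) φ.codes := by
  have hT : ∀ i, (checkTransitions φ.codes.length (φ.halfValue h h) i).flatMap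
      (fun e => [e.1, e.2.1, e.2.2]) = halfOut [rZero, rTwo, rState]
        [rState, rOne, rNext, rState, rZero, rTarget] [rState, rTwo, rOne] (2 ^ h) (2 ^ h) φ.codes i := by
    intro i
    simp [halfOut, checkTransitions, clausesOut, stateOf, env, halfValue, List.flatMap_assoc]
  have hW : ∀ i, 2 :: (List.range φ.codes.length).map (φ.halfValue h 0 i) =
      halfOut [rTwo] [rVal] [] (2 ^ h) 1 φ.codes i := by
    intro i
    simp [halfOut, clausesOut, env, halfValue, List.map_eq_flatMap]
  rw [toNFAInstance, ovInstance, NFAInstance.encode_ofNat, length_ovTransitions, length_ovWord,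
    ovTransitions, ovWord, List.flatMap_append, List.flatMap_assoc]
  simp only [hT, hW, nfaCode, passOut]
  simp

end CNFFormula

/-! ### Running times -/

/-- All the numbers that the reduction handles have a bit length linear in the numbers of variables
and clauses. -/
theorem numbers_bounded {k n : ℕ} {css : List (List ℕ)} (hk : ∀ cs ∈ css, cs.length ≤ k) :
    let B := 2 ^ (2 * ((n + 1) / 2) + css.length + k + 6)
    k + 1 ≤ B ∧ 2 ^ ((n + 1) / 2) * 2 ^ ((n + 1) / 2) ≤ B ∧ 2 * n ≤ B ∧
      (setupMem k n css).length + 7 * (2 ^ ((n + 1) / 2) * (css.length + 1)) + 25 ≤ B := by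
  intro B
  rw [length_setupMem n hk]
  set h := (n + 1) / 2 with hh
  set m := css.length
  have hA : h + 1 ≤ 2 ^ h := Nat.lt_two_pow_self
  have hM : m + 1 ≤ 2 ^ m := Nat.lt_two_pow_self
  have hK : k + 1 ≤ 2 ^ k := Nat.lt_two_pow_self
  -- The factor `64` covers the sum of the constants below, which is `38`.
  have hB : B = 2 ^ h * 2 ^ h * 2 ^ m * 2 ^ k * 64 := by
    change 2 ^ (2 * h + m + k + 6) = _
    rw [Nat.pow_add, Nat.pow_add, Nat.pow_add, Nat.two_mul, Nat.pow_add]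
  rw [hB]
  generalize 2 ^ h = a at *
  generalize 2 ^ m = b at *
  generalize 2 ^ k = c at *
  have h1 : a ≤ a * a := Nat.le_mul_self a
  have h2 : a * a ≤ a * a * b := Nat.le_mul_of_pos_right _ (by omega)
  have h3 : a * a * b ≤ a * a * b * c := Nat.le_mul_of_pos_right _ (by omega)
  have h4 : a * b ≤ a * a * b := Nat.mul_le_mul_right _ h1
  have h5 : a * (m + 1) ≤ a * b := Nat.mul_le_mul_left _ hM
  have h6 : m * (k + 1) ≤ b * c := Nat.mul_le_mul (by omega) hK
  have h7 : b * c ≤ a * a * b * c := by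
    rw [Nat.mul_assoc (a * a)]
    exact Nat.le_mul_of_pos_left _ (Nat.mul_pos (by omega) (by omega))
  have h8 : c ≤ b * c := Nat.le_mul_of_pos_left _ (by omega)
  refine ⟨by omega, by omega, by omega, by omega⟩

theorem CNFFormula.length_codes_add_two_le (φ : CNFFormula) :
    φ.codes.length + 2 ≤ φ.encode.length := by
  have : φ.codes.length ≤ (clausesCode φ.codes).length := by
    induction φ.codes with
    | nil => exact Nat.zero_le _
    | cons c css ih =>
      simp only [clausesCode_cons, List.length_append, List.length_cons]
      omega
  rw [φ.encode_eq, List.length_cons, List.length_cons]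
  omega

/-- The reduction as a statement about decision: it turns an algorithm for the automaton of a formula
into one for the formula. -/
theorem decides_satProgram {k T : ℕ} {P : Program} {φ : CNFFormula} (hφ : φ.IsKCNF k)
    (hP : Decides P (φ.toNFAInstance ((φ.numVars + 1) / 2)).encode
      (φ.toNFAInstance ((φ.numVars + 1) / 2)).Accepted T) :
    Decides (satProgram k P) φ.encode φ.Satisfiable
      (((2 ^ ((φ.numVars + 1) / 2) * φ.encode.length * (30 * k + 137) + T) *
        ((φ.numVars + 1) * φ.encode.length * (2 * k + 24)) : ℕ) : ℝ) := by
  obtain ⟨s, t, hs, hans, ht⟩ := hP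
  have ht : t ≤ T := by exact_mod_cast ht
  have hcs : ∀ cs ∈ φ.codes, cs.length ≤ k ∧ ∀ x ∈ cs, x < 2 * φ.numVars := by
    intro cs hcs
    obtain ⟨c, hc, rfl⟩ := List.mem_map.1 hcs
    refine ⟨by simpa using hφ c hc, fun x hx => ?_⟩
    obtain ⟨l, -, rfl⟩ := List.mem_map.1 hx
    have := l.1.2
    have := Bool.toNat_le l.2
    omega
  rw [φ.encode_toNFAInstance] at hs
  obtain ⟨h1, h2, h3, h4⟩ := numbers_bounded (n := φ.numVars) fun cs hc => (hcs cs hc).1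
  obtain ⟨s', t', hs', hreg, ht'⟩ := satProgram_spec hcs h1 h2 h3 h4 hs
  rw [← φ.encode_eq] at hs'
  refine ⟨s', t', hs', ?_, Nat.cast_le.2 (ht'.trans ?_)⟩
  · rw [hreg, hans, φ.accepted_toNFAInstance (by omega)]
  have hlen := φ.length_codes_add_two_le
  rw [Nat.size_pow]
  set n := φ.numVars
  set m := φ.codes.length
  set L := φ.encode.length
  have hA : (n + 1) / 2 + 1 ≤ 2 ^ ((n + 1) / 2) := Nat.lt_two_pow_self
  have hh : 2 * ((n + 1) / 2) ≤ n + 1 := by omega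
  generalize (n + 1) / 2 = h at *
  generalize 2 ^ h = A at *
  have hsteps : (2 * h + 1) * 6 + A * ((m + 1) * (30 * k + 38)) + 87 ≤ A * L * (30 * k + 137) := by
    have e1 : A * ((m + 1) * (30 * k + 38)) ≤ A * (L * (30 * k + 38)) :=
      Nat.mul_le_mul_left _ (Nat.mul_le_mul_right _ (by omega))
    have e2 : A * 1 ≤ A * L := Nat.mul_le_mul_left _ (by omega)
    have e3 : A * L * (30 * k + 137) = A * (L * (30 * k + 38)) + A * L * 99 := by ring
    omega
  have hfactor : 2 * (2 * h + m + k + 6 + 1) + 4 ≤ (n + 1) * L * (2 * k + 24) := by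
    have e1 : (n + 1) * 1 ≤ (n + 1) * L := Nat.mul_le_mul_left _ (by omega)
    have e2 : 1 * L ≤ (n + 1) * L := Nat.mul_le_mul_right _ (by omega)
    have e3 : 1 * (2 * k) ≤ (n + 1) * L * (2 * k) := Nat.mul_le_mul_right _ (by omega)
    have e4 := Nat.mul_add ((n + 1) * L) (2 * k) 24
    omega
  rw [Nat.add_mul _ T]
  exact Nat.add_le_add (Nat.mul_le_mul hsteps (by omega)) (Nat.mul_le_mul ht (by omega))

/-- A polynomial factor in the number of variables is absorbed by the exponential. -/
theorem add_one_le_mul_two_rpow {η : ℝ} (hη : 0 < η) (hη1 : η ≤ 1) (n : ℕ) :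
    (n : ℝ) + 1 ≤ 2 / η * (2 : ℝ) ^ (η * n) := by
  have h1 : 1 + η * n * Real.log 2 ≤ (2 : ℝ) ^ (η * n) := by
    rw [Real.rpow_def_of_pos two_pos, mul_comm (Real.log 2), add_comm]
    exact Real.add_one_le_exp _
  have h2 : (1 : ℝ) / 2 ≤ Real.log 2 := by linarith [Real.log_two_gt_d9]
  have h3 : η * n * (1 / 2) ≤ η * n * Real.log 2 := by gcongr
  have h4 : 2 / η * (1 + η * n * (1 / 2)) = 2 / η + n := by field_simp
  have h5 : 1 ≤ 2 / η := by rw [le_div_iff₀ hη]; linarith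
  calc (n : ℝ) + 1 ≤ 2 / η * (1 + η * n * (1 / 2)) := by rw [h4]; linarith
    _ ≤ 2 / η * (2 : ℝ) ^ (η * n) := by gcongr; linarith

theorem two_pow_half_le (n : ℕ) : ((2 ^ ((n + 1) / 2) : ℕ) : ℝ) ≤ 2 * (2 : ℝ) ^ ((n : ℝ) / 2) := by
  have h : (((n + 1) / 2 : ℕ) : ℝ) ≤ 1 + (n : ℝ) / 2 := by
    have : (((n + 1) / 2 : ℕ) : ℝ) ≤ ((n + 1 : ℕ) : ℝ) / 2 := Nat.cast_div_le
    push_cast at this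
    linarith
  rw [Nat.cast_pow, Nat.cast_two, ← Real.rpow_natCast]
  calc (2 : ℝ) ^ (((n + 1) / 2 : ℕ) : ℝ) ≤ (2 : ℝ) ^ (1 + (n : ℝ) / 2) :=
        Real.rpow_le_rpow_of_exponent_le one_le_two h
    _ = 2 * (2 : ℝ) ^ ((n : ℝ) / 2) := by rw [Real.rpow_add two_pos, Real.rpow_one]

/-- A subquadratic algorithm takes time `2 ^ ((1 - η) * n)` on the automaton of a formula with `n`
variables. -/
theorem rpow_numStates_le {η N L : ℝ} {n : ℕ} (hη : 0 ≤ η) (hη1 : 2 * η ≤ 2) (hN : 0 ≤ N) (hL : 1 ≤ L)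
    (h : N ≤ 4 * L * (2 : ℝ) ^ ((n : ℝ) / 2)) :
    N ^ (2 - 2 * η) ≤ 16 * L ^ 2 * (2 : ℝ) ^ ((1 - η) * n) := by
  calc N ^ (2 - 2 * η) ≤ (4 * L * (2 : ℝ) ^ ((n : ℝ) / 2)) ^ (2 - 2 * η) :=
        Real.rpow_le_rpow hN h (by linarith)
    _ = (4 * L) ^ (2 - 2 * η) * (2 : ℝ) ^ ((1 - η) * n) := by
        rw [Real.mul_rpow (by positivity) (by positivity), ← Real.rpow_mul two_pos.le]
        congr 2
        ring
    _ ≤ (4 * L) ^ (2 : ℝ) * (2 : ℝ) ^ ((1 - η) * n) := by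
        gcongr
        · linarith
        · linarith
    _ = 16 * L ^ 2 * (2 : ℝ) ^ ((1 - η) * n) := by
        rw [Real.rpow_two]
        ring

theorem corollary5 (ε : ℝ) (hε : 0 < ε)
    (h : ∀ K : ℕ, SparseNFAAcceptanceInTime K (2 - ε)) :
    ¬ SETH := by
  -- With `η = min ε 1 / 2` the automaton is decided in time `2 ^ ((1 - η) * n)`, and the polynomial
  -- factors in `n` cost another `2 ^ (η / 2 * n)`.
  set η : ℝ := min ε 1 / 2 with hη
  have hη0 : 0 < η := by have := lt_min hε one_pos; positivity
  have hηε : 2 * η ≤ ε := by rw [hη]; linarith [min_le_left ε 1]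
  have hη1 : 2 * η ≤ 1 := by rw [hη]; linarith [min_le_right ε 1]
  intro hS
  obtain ⟨k, hk⟩ := hS (1 - η / 2) (by linarith)
  apply hk
  obtain ⟨P, C, hP⟩ := h 3
  refine ⟨satProgram k P,
    (2 * (30 * k + 137) + 16 * max C 0) * ((2 * k + 24) * (2 / (η / 2))), 3, fun φ hφ => ?_⟩
  obtain ⟨s, T, hs, hans, hT⟩ := hP (φ.toNFAInstance ((φ.numVars + 1) / 2))
    (sparse_ovInstance _ _)
  obtain ⟨s', t', hs', hans', ht'⟩ := decides_satProgram hφ ⟨s, T, hs, hans, le_rfl⟩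
  refine ⟨s', t', hs', hans', ht'.trans ?_⟩
  have hN : (φ.toNFAInstance ((φ.numVars + 1) / 2)).numStates =
    2 ^ ((φ.numVars + 1) / 2) * (φ.codes.length + 1) + 2 := rfl
  have hNpos : 1 ≤ 2 ^ ((φ.numVars + 1) / 2) * (φ.codes.length + 1) + 2 := by omega
  have hlen : φ.codes.length + 2 ≤ φ.encode.length := φ.length_codes_add_two_le
  have hNle : 2 ^ ((φ.numVars + 1) / 2) * (φ.codes.length + 1) + 2 ≤
      2 * φ.encode.length * 2 ^ ((φ.numVars + 1) / 2) := by
    have := Nat.one_le_two_pow (n := (φ.numVars + 1) / 2)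
    nlinarith
  rw [hN] at hT
  set n := φ.numVars
  set L := φ.encode.length
  have hA := two_pow_half_le n
  generalize 2 ^ ((n + 1) / 2) * (φ.codes.length + 1) + 2 = N at *
  generalize 2 ^ ((n + 1) / 2) = A at *
  have hL : (1 : ℝ) ≤ L := by exact_mod_cast (by omega : 1 ≤ L)
  have hN1 : (1 : ℝ) ≤ N := by exact_mod_cast hNpos
  have hN4 : (N : ℝ) ≤ 4 * L * (2 : ℝ) ^ ((n : ℝ) / 2) := by
    calc (N : ℝ) ≤ 2 * L * A := by exact_mod_cast hNle
      _ ≤ 2 * L * (2 * (2 : ℝ) ^ ((n : ℝ) / 2)) := by gcongr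
      _ = 4 * L * (2 : ℝ) ^ ((n : ℝ) / 2) := by ring
  have hT' : (T : ℝ) ≤ max C 0 * (16 * L ^ 2 * (2 : ℝ) ^ ((1 - η) * n)) := by
    calc (T : ℝ) ≤ C * (N : ℝ) ^ (2 - ε) := hT
      _ ≤ max C 0 * (N : ℝ) ^ (2 - ε) := by gcongr; exact le_max_left _ _
      _ ≤ max C 0 * (N : ℝ) ^ (2 - 2 * η) := by gcongr
      _ ≤ max C 0 * (16 * L ^ 2 * (2 : ℝ) ^ ((1 - η) * n)) := by
        gcongr
        exact rpow_numStates_le hη0.le (by linarith) (by linarith) hL hN4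
  have hA' : (A : ℝ) ≤ 2 * (2 : ℝ) ^ ((1 - η) * n) := by
    refine hA.trans ?_
    gcongr
    · exact one_le_two
    · nlinarith [Nat.cast_nonneg (α := ℝ) n]
  have hn := add_one_le_mul_two_rpow (η := η / 2) (by linarith) (by linarith) n
  have hLL : (L : ℝ) ≤ L ^ 2 := by nlinarith
  have hexp : (2 : ℝ) ^ ((1 - η / 2) * n) = (2 : ℝ) ^ ((1 - η) * n) * (2 : ℝ) ^ (η / 2 * n) := by
    rw [← Real.rpow_add two_pos]
    congr 1
    ring
  rw [hexp]
  push_cast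
  set E := (2 : ℝ) ^ ((1 - η) * n)
  have hE : 0 < E := Real.rpow_pos_of_pos two_pos _
  calc ((A : ℝ) * L * (30 * k + 137) + T) * ((n + 1) * L * (2 * k + 24))
      ≤ (2 * E * L ^ 2 * (30 * k + 137) + max C 0 * (16 * L ^ 2 * E)) *
          (2 / (η / 2) * (2 : ℝ) ^ (η / 2 * n) * L * (2 * k + 24)) := by gcongr
    _ = _ := by ring
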